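/- **Setting.** Let $\alpha\in(0,1)$, $\beta>0$. For $N\ge 1$ let $\mathbf J=(J_{ij})_{1\le i<j\le N}$ be i.i.d. with density $\frac{\alpha}{2N}|x|^{-(1+\alpha)}\mathbf 1\{|x|\ge N^{-1/\alpha}\}$, and let $\mathbb P_{\mathbf J}$ be their law. On $\{\pm1\}^N$ put $H(\sigma)=\sum_{i<j}J_{ij}\sigma_i\sigma_j$ and $\pi(\sigma)\propto e^{\beta H(\sigma)}$. The Glauber dynamics $(X(t))_{t\ge0}$ is the continuous-time Markov chain in which every vertex has a rate-$1$ Poisson clock and, when the clock of $v$ rings, $\sigma_v$ is resampled from $\pi$ conditionally on all the other spins. For $a>0$ and $\gamma>0$ let $t_{a,\gamma}=e^{aN^\gamma}$, let $E_{a,\gamma}=\{(i,j):i<j,\ |J_{ij}|\ge\frac{a}{2\beta}N^\gamma\}$, and let $V_{a,\gamma}$ be the set of endpoints of the bonds in $E_{a,\gamma}$. A $t_{a,\gamma}$-metastable well is a connected component, in the hypercube graph, of the set $\{\sigma:\sigma_i\sigma_j=\operatorname{sgn}J_{ij}\text{ for all }(i,j)\in E_{a,\gamma}\}$. The Glauber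 dynamics restricted to a well $\mathcal C$ is started in $\mathcal C$ and rejects all updates at vertices of $V_{a,\gamma}$; its mixing time is $$t^{\mathcal C}_{\rm mix}=\inf\Big\{t>0:\max_{\sigma\in\mathcal C}d_{\rm TV}\big(\mathbb P_\sigma(\overline X(t)\in\cdot),\pi(\cdot\mid\mathcal C)\big)<\tfrac14\Big\},$$ where $\overline X$ is the restricted chain. The escape time of the (unrestricted) Glauber dynamics from $\mathcal C$ is $\tau_{\mathcal C}=\inf\{t\ge 0:X(t)\notin\mathcal C\}$. **Theorem.** Let $\alpha\in(0,1)$, $\beta>0$, $a>0$ and $\gamma\in(\gamma_0,\frac1\alpha)$, where $\gamma_0=\frac{5\alpha+1}{2\alpha(2\alpha+1)}$. There are $\eta>0$, $c>0$ and a deterministic sequence $\delta_N\to0$ such that, with $\mathbb P_{\mathbf J}$-probability $1-o(1)$ as $N\to\infty$, every $t_{a,\gamma}$-metastable well $\mathcal C$ satisfies $$t^{\mathcal C}_{\rm mix}\le e^{-N^\eta}\,t_{a,\gamma} \qquad\text{and}\qquad \mathbb P_\sigma\big(\tau_{\mathcal C}<c\,t_{a,\gamma}\big)\le\delta_N\quad\text{for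 all }\sigma\in\mathcal C .$$ -/

import Mathlib

open Filter Topology MeasureTheory
open scoped NNReal ENNReal

noncomputable section

namespace LevySpinGlass

/-- Spin configurations `Σ_N = {±1}^N`; the two-element group `ℤˣ` plays the role of `{±1}`. -/
abbrev Config (N : ℕ) : Type := Fin N → ℤˣ

/-- The bonds: pairs `i < j` of vertices. -/
abbrev Bond (N : ℕ) : Type := {p : Fin N × Fin N // p.1 < p.2}

/-- A realization `(J_{ij})_{i<j}` of the couplings. -/
abbrev Couplings (N : ℕ) : Type := Bond N → ℝ

/-- The spin at vertex `i`, as a real number `±1`. -/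
def spin {N : ℕ} (σ : Config N) (i : Fin N) : ℝ := ((σ i : ℤ) : ℝ)

/-! ### Disorder -/

/-- The law of a single coupling, with density
`(α / 2N) |x|^{-(1+α)} 1{|x| ≥ N^{-1/α}}`. -/
def bondLaw (α : ℝ) (N : ℕ) : Measure ℝ :=
  volume.withDensity fun x =>
    ENNReal.ofReal
      (if (N : ℝ) ^ (-(1 / α)) ≤ |x| then α / (2 * N) * |x| ^ (-(1 + α)) else 0)

/-- The law of the couplings: i.i.d. over the bonds. -/
def couplingLaw (α : ℝ) (N : ℕ) : Measure (Couplings N) :=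
  Measure.pi fun _ => bondLaw α N

/-! ### Hamiltonian and Gibbs measure -/

/-- `H_J(σ) = ∑_{i<j} J_{ij} σ_i σ_j`. -/
def hamiltonian {N : ℕ} (J : Couplings N) (σ : Config N) : ℝ :=
  ∑ e : Bond N, J e * spin σ e.1.1 * spin σ e.1.2

/-- The Gibbs measure `π(σ) ∝ e^{β H(σ)}` (positive sign in the exponent). -/
def gibbs {N : ℕ} (β : ℝ) (J : Couplings N) (σ : Config N) : ℝ :=
  Real.exp (β * hamiltonian J σ) / ∑ η : Config N, Real.exp (β * hamiltonian J η)

open Classical in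
/-- The Gibbs measure conditioned on a set `C` of configurations, `π(· | C)`. -/
def gibbsOn {N : ℕ} (β : ℝ) (J : Couplings N) (C : Set (Config N)) (σ : Config N) : ℝ :=
  if σ ∈ C then gibbs β J σ / ∑ η : Config N, (if η ∈ C then gibbs β J η else 0) else 0

/-! ### Glauber dynamics -/

/-- Transition matrix of a single update at `v`: the spin at `v` is resampled from its
conditional Gibbs law given all the other spins, which are kept. -/
def heatBath {N : ℕ} (β : ℝ) (J : Couplings N) (v : Fin N) :
    Matrix (Config N) (Config N) ℝ :=
  Matrix.of fun σ η =>
    if ∀ w, w ≠ v → η w = σ w then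
      gibbs β J η / ∑ ζ : Config N, (if ∀ w, w ≠ v → ζ w = σ w then gibbs β J ζ else 0)
    else 0

/-- Generator of the continuous-time dynamics in which every vertex of `U` has a rate-one
Poisson clock and is resampled when its clock rings, while vertices outside `U` are never
updated. -/
def glauberGenerator {N : ℕ} (β : ℝ) (J : Couplings N) (U : Set (Fin N)) :
    Matrix (Config N) (Config N) ℝ :=
  open Classical in ∑ v : Fin N, if v ∈ U then heatBath β J v - 1 else 0

/-- Transition probabilities at time `t` of the continuous-time Markov chain on a finite set
with generator `Q`. -/
def transition {S : Type*} [Fintype S] [DecidableEq S] (Q : Matrix S S ℝ) (t : ℝ) :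
    Matrix S S ℝ :=
  NormedSpace.exp (t • Q)

/-- `X` is a continuous-time Markov chain on the finite set `S` with generator `Q` and initial
state `x₀`: right-continuous paths, and the finite-dimensional distributions given by the
transition probabilities. -/
structure IsMarkovChain {S : Type*} [Fintype S] [DecidableEq S] (Q : Matrix S S ℝ) (x₀ : S)
    {Ω : Type*} [MeasurableSpace Ω] (μ : Measure Ω) (X : ℝ≥0 → Ω → S) : Prop where
  measurable : ∀ t x, MeasurableSet {ω | X t ω = x}
  right_continuous : ∀ ω t, ∀ᶠ s in 𝓝[≥] t, X s ω = X t ω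
  law : ∀ (n : ℕ) (t : ℕ → ℝ≥0) (x : ℕ → S), Monotone t → t 0 = 0 → x 0 = x₀ →
    μ {ω | ∀ i ≤ n, X (t i) ω = x i} =
      ENNReal.ofReal (∏ i ∈ Finset.range n, transition Q (t (i + 1) - t i) (x i) (x (i + 1)))

/-- First time at which the path leaves `C` (equal to `∞` if it never does). -/
def escapeTime {S Ω : Type*} (X : ℝ≥0 → Ω → S) (C : Set S) (ω : Ω) : ℝ≥0∞ :=
  ⨅ (t : ℝ≥0) (_ : X t ω ∉ C), (t : ℝ≥0∞)

/-- Total-variation distance of two probability vectors on a finite set. -/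
def tvDist {S : Type*} [Fintype S] (p q : S → ℝ) : ℝ := (∑ x, |p x - q x|) / 2

/-- `inf {t > 0 : max_{x₀ ∈ C} d_TV(P_{x₀}(X_t ∈ ·), π) < 1/4}` for the chain with generator `Q`
started in `C`; the infimum is taken in `[0, ∞]`, so it is `∞` if there is no such `t`. -/
def mixingTime {S : Type*} [Fintype S] [DecidableEq S] (Q : Matrix S S ℝ) (C : Set S)
    (π : S → ℝ) : ℝ≥0∞ :=
  ⨅ (t : ℝ) (_ : 0 < t ∧ ∀ x₀ ∈ C, tvDist (transition Q t x₀) π < 1 / 4), ENNReal.ofReal t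

/-! ### Metastable wells -/

/-- The timescale `t_{a,γ} = e^{a N^γ}`. -/
def timescale (a γ : ℝ) (N : ℕ) : ℝ := Real.exp (a * (N : ℝ) ^ γ)

/-- `E_{a,γ}`: the bonds with `|J_{ij}| ≥ (a / 2β) N^γ`. -/
def relevantBonds {N : ℕ} (β a γ : ℝ) (J : Couplings N) : Set (Bond N) :=
  {e | a / (2 * β) * (N : ℝ) ^ γ ≤ |J e|}

/-- `V_{a,γ}`: the endpoints of bonds in `E_{a,γ}`. -/
def relevantVertices {N : ℕ} (β a γ : ℝ) (J : Couplings N) : Set (Fin N) :=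
  {i | ∃ e ∈ relevantBonds β a γ J, i = e.1.1 ∨ i = e.1.2}

/-- `Sat(σ)`: the bonds satisfied by `σ`. -/
def sat {N : ℕ} (J : Couplings N) (σ : Config N) : Set (Bond N) :=
  {e | spin σ e.1.1 * spin σ e.1.2 = Real.sign (J e)}

/-- The hypercube graph on `{±1}^N`. -/
def hypercube (N : ℕ) : SimpleGraph (Config N) where
  Adj σ η := hammingDist σ η = 1
  symm := ⟨fun σ η h => by rw [hammingDist_comm]; exact h⟩
  loopless := ⟨fun σ h => by simp at h⟩

/-- The configurations satisfying all relevant bonds. -/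
def satisfyingConfigs {N : ℕ} (β a γ : ℝ) (J : Couplings N) : Set (Config N) :=
  {σ | relevantBonds β a γ J ⊆ sat J σ}

/-- `C` is a `t_{a,γ}`-metastable well: a connected component, in the hypercube, of the set
`{σ : Sat(σ) ⊇ E_{a,γ}}`. -/
def IsWell {N : ℕ} (β a γ : ℝ) (J : Couplings N) (C : Set (Config N)) : Prop :=
  ∃ c : ((hypercube N).induce (satisfyingConfigs β a γ J)).ConnectedComponent,
    C = Subtype.val '' c.supp

/-- Mixing time of the Glauber dynamics restricted to the well `C`: the chain is started in `C`,
all updates at the relevant vertices are rejected, and its equilibrium is `π(· | C)`. -/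
def wellMixingTime {N : ℕ} (β a γ : ℝ) (J : Couplings N) (C : Set (Config N)) : ℝ≥0∞ :=
  mixingTime (glauberGenerator β J (relevantVertices β a γ J)ᶜ) C (gibbsOn β J C)

end LevySpinGlass

end

open LevySpinGlass

/-!
Why the wells are metastable.

Let `X = (a / 2β) N ^ γ` be the threshold of the relevant bonds. Since `γ` exceeds
`1 / (2α) + 1 / (1 + α)`, there are exponents `κ > 1 / (2α)` and `1 < s < θ` with
`1 + κ (1 - α) < s` and `θ < γ (1 + α) - 1` (`exists_exponents`). With probability `1 - o(1)` three
things then hold at once (`IsTypical`, `tendsto_not_typical`): the strong bonds `|J e| ≥ N ^ κ` form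
a matching, by a first-moment count of adjacent pairs; the weak bonds have total strength at most
`N ^ s`, by Markov's inequality; and no bond has strength within `N ^ θ` of `X`, because the
density of a coupling near `X` is of order `N ^ (-1 - γ (1 + α))`. From here on everything is
deterministic. Up to an energy `O(N ^ s)`, which is negligible against `N ^ θ`, the system consists
of independent pairs and single vertices, and the strengths of the pairs stay away from `X`.

A well is the set of all configurations with prescribed spins at the relevant vertices
(`IsWell.exists_eq`).

*Escape.* To leave a well the dynamics must break a relevant bond, of strength at least
`X + N ^ θ`, which happens at rate at most `N exp (-2β (X + N ^ θ) + 2β N ^ s)`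
(`hamiltonian_flip_sub_le`, `glauberGenerator_exit_le`). As `exp (2β X)` is the time scale, the
escape probability is at most `N exp (-2β N ^ θ + 2β N ^ s)` (`measure_escapeTime_lt_le`).

*Mixing.* The restricted dynamics is reversible for the conditioned Gibbs measure, so a Poincaré
inequality bounds its mixing time (`mixingTime_le`). Two configurations of the well are joined by a
path that exchanges their spins one strong pair at a time. Exchanges preserve the sum of the two
energies up to weak bonds (`hamiltonian_exchange_le`), and within one exchange the path climbs at
most twice the strength of an irrelevant bond, which is at most `X - N ^ θ`
(`hamiltonian_sub_flip_le`). The Poincaré constant is therefore at most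
`exp (2β X - 2β N ^ θ + O(N ^ s))` (`gibbsOn_poincare`); since `s > 1`, crude factors such as the
number `4 ^ N` of pairs of configurations do no harm. The relevant bonds are constant inside the
well, so the smallest atom of the conditioned measure is at least `exp (-poly N)`
(`le_gibbsOn_well`), and the mixing time is at most `exp (-N ^ s) exp (2β X)`
(`eventually_relaxed`).
-/

noncomputable section

namespace LevySpinGlass

/-! ### Continuous-time chains on a finite set -/

section FiniteChain

variable {S : Type*} [Fintype S]

/-- `Q` is a rate matrix: jump rates are nonnegative and every row sums to zero. -/
structure IsRateMatrix (Q : Matrix S S ℝ) : Prop where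
  nonneg : ∀ x y, x ≠ y → 0 ≤ Q x y
  row_sum : ∀ x, ∑ y, Q x y = 0

/-- For a measure `π` that is reversible for `Q`, the Dirichlet form is minus the quadratic form
of the generator. -/
lemma dirichlet_eq {Q : Matrix S S ℝ} (hQ : IsRateMatrix Q) {π : S → ℝ}
    (hrev : ∀ x y, π x * Q x y = π y * Q y x) (g : S → ℝ) :
    ∑ x, ∑ y, π x * Q x y * (g x - g y) ^ 2 = -(2 * ∑ x, π x * g x * ∑ y, Q x y * g y) := by
  have h1 : ∑ x, ∑ y, π x * Q x y * g x ^ 2 = 0 := by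
    refine Finset.sum_eq_zero fun x _ => ?_
    rw [← Finset.sum_mul, ← Finset.mul_sum, hQ.row_sum]
    ring
  have h2 : ∑ x, ∑ y, π x * Q x y * g y ^ 2 = 0 := by
    rw [Finset.sum_comm]
    refine Finset.sum_eq_zero fun y _ => ?_
    simp only [hrev _ y]
    rw [← Finset.sum_mul, ← Finset.mul_sum, hQ.row_sum]
    ring
  have h3 : ∑ x, ∑ y, π x * Q x y * (g x - g y) ^ 2 =
      ∑ x, ∑ y, π x * Q x y * g x ^ 2 + ∑ x, ∑ y, π x * Q x y * g y ^ 2 -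
        2 * ∑ x, π x * g x * ∑ y, Q x y * g y := by
    simp only [Finset.mul_sum, ← Finset.sum_add_distrib, ← Finset.sum_sub_distrib]
    refine Finset.sum_congr rfl fun x _ => Finset.sum_congr rfl fun y _ => ?_
    ring
  rw [h3, h1, h2]
  ring

variable [DecidableEq S]

section Exp

attribute [local instance] Matrix.linftyOpNormedRing Matrix.linftyOpNormedAlgebra

lemma hasDerivAt_transition (Q : Matrix S S ℝ) (t : ℝ) (x y : S) :
    HasDerivAt (fun u => transition Q u x y) ((transition Q t * Q) x y) t := by
  have h := hasDerivAt_exp_smul_const (𝕂 := ℝ) Q t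
  exact hasDerivAt_pi.1 (hasDerivAt_pi.1 h x) y

lemma hasDerivAt_transition' (Q : Matrix S S ℝ) (t : ℝ) (x y : S) :
    HasDerivAt (fun u => transition Q u x y) ((Q * transition Q t) x y) t := by
  have h := hasDerivAt_exp_smul_const' (𝕂 := ℝ) Q t
  exact hasDerivAt_pi.1 (hasDerivAt_pi.1 h x) y

lemma exp_apply_nonneg {A : Matrix S S ℝ} (hA : ∀ x y, 0 ≤ A x y) (x y : S) :
    0 ≤ NormedSpace.exp A x y := by
  have h : HasSum (fun n : ℕ => ((n.factorial : ℝ)⁻¹ • A ^ n) x y) (NormedSpace.exp A x y) :=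
    Pi.hasSum.1 (Pi.hasSum.1 (NormedSpace.exp_series_hasSum_exp' (𝕂 := ℝ) A) x) y
  refine h.nonneg fun n => ?_
  have hpow : ∀ n : ℕ, ∀ x y, 0 ≤ (A ^ n) x y := by
    intro n
    induction n with
    | zero =>
      intro x y
      rw [pow_zero, Matrix.one_apply]
      split_ifs <;> norm_num
    | succ n ih =>
      intro x y
      rw [pow_succ, Matrix.mul_apply]
      exact Finset.sum_nonneg fun z _ => mul_nonneg (ih x z) (hA z y)
  rw [Matrix.smul_apply, smul_eq_mul]
  exact mul_nonneg (by positivity) (hpow n x y)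

lemma transition_zero (Q : Matrix S S ℝ) : transition Q 0 = 1 := by
  simp [transition]

/-- Transition probabilities are nonnegative: after the shift `Q + c • 1`, which only multiplies
the exponential by a positive scalar, all entries of the generator are nonnegative. -/
lemma transition_nonneg {Q : Matrix S S ℝ} (hQ : IsRateMatrix Q) {t : ℝ} (ht : 0 ≤ t) (x y : S) :
    0 ≤ transition Q t x y := by
  set c : ℝ := ∑ z, |Q z z| with hc
  have hpos : ∀ z w, 0 ≤ (t • Q + (t * c) • (1 : Matrix S S ℝ)) z w := by
    intro z w
    simp only [Matrix.add_apply, Matrix.smul_apply, smul_eq_mul, Matrix.one_apply]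
    rw [mul_assoc, ← mul_add]
    refine mul_nonneg ht ?_
    split_ifs with h
    · subst h
      have : |Q z z| ≤ c := Finset.single_le_sum (f := fun z => |Q z z|)
        (fun i _ => abs_nonneg _) (Finset.mem_univ z)
      have := neg_abs_le (Q z z)
      linarith
    · simpa using hQ.nonneg z w h
  have hcomm : Commute (t • Q + (t * c) • (1 : Matrix S S ℝ))
      ((-(t * c)) • (1 : Matrix S S ℝ)) := (Commute.one_right _).smul_right _
  have heq : transition Q t = Real.exp (-(t * c)) •
      NormedSpace.exp (t • Q + (t * c) • (1 : Matrix S S ℝ)) := by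
    have h1 : t • Q = (t • Q + (t * c) • (1 : Matrix S S ℝ)) + (-(t * c)) • 1 := by
      rw [add_assoc, ← add_smul]; simp
    have h2 : NormedSpace.exp ((-(t * c)) • (1 : Matrix S S ℝ)) =
        Real.exp (-(t * c)) • (1 : Matrix S S ℝ) := by
      rw [← Algebra.algebraMap_eq_smul_one, ← Algebra.algebraMap_eq_smul_one, Real.exp_eq_exp_ℝ]
      exact (NormedSpace.algebraMap_exp_comm (𝕂 := ℝ) (𝔸 := Matrix S S ℝ) (-(t * c))).symm
    have h3 := Matrix.exp_add_of_commute _ _ hcomm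
    rw [← h1, h2, mul_smul_comm, mul_one] at h3
    exact h3
  rw [heq, Matrix.smul_apply, smul_eq_mul]
  exact mul_nonneg (Real.exp_pos _).le (exp_apply_nonneg hpos x y)

end Exp

lemma transition_row_sum {Q : Matrix S S ℝ} (hQ : IsRateMatrix Q) (t : ℝ) (x : S) :
    ∑ y, transition Q t x y = 1 := by
  have hd : ∀ u, HasDerivAt (fun u => ∑ y, transition Q u x y) 0 u := by
    intro u
    have h := HasDerivAt.fun_sum (u := Finset.univ) fun y _ => hasDerivAt_transition Q u x y
    refine h.congr_deriv ?_
    simp only [Matrix.mul_apply]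
    rw [Finset.sum_comm]
    simp [← Finset.mul_sum, hQ.row_sum]
  have := is_const_of_deriv_eq_zero (fun u => (hd u).differentiableAt) (fun u => (hd u).deriv) t 0
  rw [this, transition_zero]
  simp [Matrix.one_apply]

open Classical in
/-- If every state of `C` has exit rate at most `r`, then within time `t` the chain started in `C`
is outside `C` with probability at most `r t`. -/
lemma transition_exit_le {Q : Matrix S S ℝ} (hQ : IsRateMatrix Q) {C : Set S} {r : ℝ}
    (hr0 : 0 ≤ r) (hr : ∀ z ∈ C, ∑ y, (if y ∈ C then 0 else Q z y) ≤ r) {x : S} (hx : x ∈ C)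
    {t : ℝ} (ht : 0 ≤ t) : ∑ y, (if y ∈ C then 0 else transition Q t x y) ≤ r * t := by
  set F : ℝ → ℝ := fun u => r * u - ∑ y, (if y ∈ C then 0 else transition Q u x y) with hF
  have hd : ∀ u, HasDerivAt F
      (r - ∑ y, (if y ∈ C then 0 else (transition Q u * Q) x y)) u := by
    intro u
    refine HasDerivAt.sub (by simpa using (hasDerivAt_id u).const_mul r) ?_
    refine HasDerivAt.fun_sum fun y _ => ?_
    split_ifs
    · exact hasDerivAt_const _ _
    · exact hasDerivAt_transition Q u x y
  have hout : ∀ z, z ∉ C → ∑ y, (if y ∈ C then 0 else Q z y) ≤ 0 := by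
    intro z hz
    have h1 : ∑ y, (if y ∈ C then 0 else Q z y) + ∑ y, (if y ∈ C then Q z y else 0) = 0 := by
      rw [← Finset.sum_add_distrib]
      refine Eq.trans ?_ (hQ.row_sum z)
      refine Finset.sum_congr rfl fun y _ => ?_
      split_ifs <;> simp
    have h2 : 0 ≤ ∑ y, (if y ∈ C then Q z y else 0) := by
      refine Finset.sum_nonneg fun y _ => ?_
      split_ifs with h
      · exact hQ.nonneg z y (fun e => hz (e ▸ h))
      · exact le_rfl
    linarith
  have hmono : MonotoneOn F (Set.Ici 0) := by
    refine monotoneOn_of_deriv_nonneg (convex_Ici 0)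
      (fun u _ => (hd u).continuousAt.continuousWithinAt)
      (fun u _ => (hd u).differentiableAt.differentiableWithinAt) fun u hu => ?_
    rw [interior_Ici] at hu
    rw [(hd u).deriv, sub_nonneg]
    have h1 : ∑ y, (if y ∈ C then 0 else (transition Q u * Q) x y) =
        ∑ z, transition Q u x z * ∑ y, (if y ∈ C then 0 else Q z y) := by
      simp only [Finset.mul_sum, Matrix.mul_apply]
      rw [Finset.sum_comm]
      refine Finset.sum_congr rfl fun y _ => ?_
      split_ifs <;> simp
    rw [h1]
    calc _ ≤ ∑ z, transition Q u x z * r := by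
          refine Finset.sum_le_sum fun z _ =>
            mul_le_mul_of_nonneg_left ?_ (transition_nonneg hQ (le_of_lt hu) x z)
          by_cases hz : z ∈ C
          · exact hr z hz
          · exact (hout z hz).trans hr0
      _ = r := by rw [← Finset.sum_mul, transition_row_sum hQ, one_mul]
  have h0 : F 0 = 0 := by
    simp only [hF, transition_zero, mul_zero, zero_sub, neg_eq_zero]
    refine Finset.sum_eq_zero fun y _ => ?_
    split_ifs with h
    · rfl
    · exact Matrix.one_apply_ne (fun e => h (e ▸ hx))
  have := hmono (Set.mem_Ici.2 le_rfl) (Set.mem_Ici.2 ht) ht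
  rw [h0] at this
  simpa [hF] using this

/-! ### Spectral gap and mixing -/

/-- A Poincaré inequality with constant `K` makes the variance decay at rate `2 / K`. -/
lemma sum_sq_transition_le {Q : Matrix S S ℝ} (hQ : IsRateMatrix Q) {π : S → ℝ}
    (hπ1 : ∑ x, π x = 1)
    (hrev : ∀ x y, π x * Q x y = π y * Q y x) {K : ℝ} (hK : 0 < K)
    (hP : ∀ f : S → ℝ, ∑ x, ∑ y, π x * π y * (f x - f y) ^ 2 ≤
      K * ∑ x, ∑ y, π x * Q x y * (f x - f y) ^ 2)
    {f : S → ℝ} (hf : ∑ x, π x * f x = 0) {t : ℝ} (ht : 0 ≤ t) :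
    ∑ x, π x * (∑ y, transition Q t x y * f y) ^ 2 ≤
      Real.exp (-(2 * t / K)) * ∑ x, π x * f x ^ 2 := by
  set g : ℝ → S → ℝ := fun u x => ∑ y, transition Q u x y * f y with hg
  have hgd : ∀ u x, HasDerivAt (fun u => g u x) (∑ y, Q x y * g u y) u := by
    intro u x
    have h := HasDerivAt.fun_sum (u := Finset.univ)
      fun y _ => (hasDerivAt_transition' Q u x y).mul_const (f y)
    refine h.congr_deriv ?_
    simp only [hg, Matrix.mul_apply, Finset.mul_sum, Finset.sum_mul]
    rw [Finset.sum_comm]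
    simp only [mul_assoc]
  have hstat : ∀ h : S → ℝ, ∑ x, π x * ∑ y, Q x y * h y = 0 := by
    intro h
    simp only [Finset.mul_sum, ← mul_assoc]
    rw [Finset.sum_comm]
    refine Finset.sum_eq_zero fun y _ => ?_
    simp only [hrev _ y]
    rw [← Finset.sum_mul, ← Finset.mul_sum, hQ.row_sum]
    ring
  have hg0 : g 0 = f := by
    ext x
    simp [hg, transition_zero, Matrix.one_apply]
  have hmean : ∀ u, ∑ x, π x * g u x = 0 := by
    intro u
    have hd : ∀ u, HasDerivAt (fun u => ∑ x, π x * g u x) 0 u := by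
      intro u
      have h := HasDerivAt.fun_sum (u := Finset.univ) fun x _ => (hgd u x).const_mul (π x)
      exact h.congr_deriv (hstat _)
    rw [is_const_of_deriv_eq_zero (fun u => (hd u).differentiableAt) (fun u => (hd u).deriv) u 0,
      hg0, hf]
  set V : ℝ → ℝ := fun u => ∑ x, π x * g u x ^ 2 with hV
  have hVd : ∀ u, HasDerivAt V (2 * ∑ x, π x * g u x * ∑ y, Q x y * g u y) u := by
    intro u
    have h := HasDerivAt.fun_sum (u := Finset.univ) fun x _ => ((hgd u x).pow 2).const_mul (π x)
    refine h.congr_deriv ?_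
    rw [Finset.mul_sum]
    refine Finset.sum_congr rfl fun x _ => ?_
    simp
    ring
  have hvar : ∀ u, ∑ x, ∑ y, π x * π y * (g u x - g u y) ^ 2 = 2 * V u := by
    intro u
    have h3 : ∑ x, ∑ y, π x * π y * (g u x - g u y) ^ 2 =
        (∑ x, π x * g u x ^ 2) * (∑ y, π y) + (∑ x, π x) * (∑ y, π y * g u y ^ 2) -
        2 * ((∑ x, π x * g u x) * ∑ y, π y * g u y) := by
      simp only [Finset.sum_mul_sum]
      simp only [Finset.mul_sum, ← Finset.sum_add_distrib, ← Finset.sum_sub_distrib]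
      refine Finset.sum_congr rfl fun x _ => Finset.sum_congr rfl fun y _ => ?_
      ring
    rw [h3, hmean, hπ1]
    simp only [hV]
    ring
  have hVle : ∀ u, 2 * ∑ x, π x * g u x * ∑ y, Q x y * g u y ≤ -(2 / K) * V u := by
    intro u
    have h := hP (g u)
    rw [dirichlet_eq hQ hrev, hvar] at h
    have : 2 / K * V u ≤ -(2 * ∑ x, π x * g u x * ∑ y, Q x y * g u y) := by
      rw [div_mul_eq_mul_div, div_le_iff₀ hK]
      linarith
    linarith
  set G : ℝ → ℝ := fun u => Real.exp (2 / K * u) * V u with hG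
  have hGd : ∀ u, HasDerivAt G (Real.exp (2 / K * u) * (2 / K) * V u +
      Real.exp (2 / K * u) * (2 * ∑ x, π x * g u x * ∑ y, Q x y * g u y)) u := by
    intro u
    have h1 : HasDerivAt (fun u => Real.exp (2 / K * u)) (Real.exp (2 / K * u) * (2 / K)) u := by
      simpa using ((hasDerivAt_id u).const_mul (2 / K)).exp
    exact h1.mul (hVd u)
  have hanti : Antitone G := by
    refine antitone_of_deriv_nonpos (fun u => (hGd u).differentiableAt) fun u => ?_
    rw [(hGd u).deriv]
    have := mul_le_mul_of_nonneg_left (hVle u) (Real.exp_pos (2 / K * u)).le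
    linarith
  have h := hanti ht
  simp only [hG, mul_zero, Real.exp_zero, one_mul] at h
  have hV0 : V 0 = ∑ x, π x * f x ^ 2 := by simp only [hV, hg0]
  rw [hV0] at h
  have he : Real.exp (-(2 * t / K)) * Real.exp (2 / K * t) = 1 := by
    rw [← Real.exp_add]
    simp only [Real.exp_eq_one_iff]
    ring
  calc V t = Real.exp (-(2 * t / K)) * (Real.exp (2 / K * t) * V t) := by
        rw [← mul_assoc, he, one_mul]
    _ ≤ _ := mul_le_mul_of_nonneg_left h (Real.exp_pos _).le

/-- A Poincaré inequality with constant `K` bounds the distance to equilibrium. The test function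
is the sign of `P_t(x₀, ·) - π`, so that no absolute continuity of `P_t(x₀, ·)` is needed. -/
lemma tvDist_sq_le {Q : Matrix S S ℝ} (hQ : IsRateMatrix Q) {π : S → ℝ}
    (hπ0 : ∀ x, 0 ≤ π x) (hπ1 : ∑ x, π x = 1)
    (hrev : ∀ x y, π x * Q x y = π y * Q y x) {K : ℝ} (hK : 0 < K)
    (hP : ∀ f : S → ℝ, ∑ x, ∑ y, π x * π y * (f x - f y) ^ 2 ≤
      K * ∑ x, ∑ y, π x * Q x y * (f x - f y) ^ 2) {t : ℝ} (ht : 0 ≤ t) (x₀ : S) :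
    π x₀ * tvDist (transition Q t x₀) π ^ 2 ≤ Real.exp (-(2 * t / K)) := by
  set s : S → ℝ := fun y => if 0 ≤ transition Q t x₀ y - π y then 1 else -1 with hs
  set m : ℝ := ∑ y, π y * s y with hm
  have hs1 : ∀ y, |s y| ≤ 1 := by
    intro y
    simp only [hs]
    split_ifs <;> simp
  have hm1 : |m| ≤ 1 := by
    calc |m| ≤ ∑ y, |π y * s y| := Finset.abs_sum_le_sum_abs _ _
      _ ≤ ∑ y, π y := Finset.sum_le_sum fun y _ => by
          rw [abs_mul, abs_of_nonneg (hπ0 y)]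
          exact mul_le_of_le_one_right (hπ0 y) (hs1 y)
      _ = 1 := hπ1
  have hf : ∑ x, π x * (s x - m) = 0 := by
    simp only [mul_sub, Finset.sum_sub_distrib, ← Finset.sum_mul, hπ1, ← hm]
    ring
  have hdecay := sum_sq_transition_le hQ hπ1 hrev hK hP hf ht
  have htv : 2 * tvDist (transition Q t x₀) π = ∑ y, transition Q t x₀ y * (s y - m) := by
    have h1 : ∑ y, transition Q t x₀ y * (s y - m) =
        ∑ y, (transition Q t x₀ y - π y) * s y := by
      simp only [mul_sub, sub_mul, Finset.sum_sub_distrib, ← Finset.sum_mul,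
        transition_row_sum hQ, ← hm]
      ring
    rw [h1, tvDist]
    rw [mul_div_cancel₀ _ (two_ne_zero)]
    refine Finset.sum_congr rfl fun y _ => ?_
    simp only [hs]
    split_ifs with h
    · rw [abs_of_nonneg h, mul_one]
    · rw [abs_of_neg (not_le.1 h)]; ring
  have hV0 : ∑ x, π x * (s x - m) ^ 2 ≤ 4 := by
    calc _ ≤ ∑ x, π x * 4 := by
          refine Finset.sum_le_sum fun x _ => mul_le_mul_of_nonneg_left ?_ (hπ0 x)
          have h1 := abs_le.1 (hs1 x)
          have h2 := abs_le.1 hm1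
          nlinarith
      _ = 4 := by rw [← Finset.sum_mul, hπ1, one_mul]
  have hsingle : π x₀ * (2 * tvDist (transition Q t x₀) π) ^ 2 ≤
      ∑ x, π x * (∑ y, transition Q t x y * (s y - m)) ^ 2 := by
    rw [htv]
    exact Finset.single_le_sum
      (f := fun x => π x * (∑ y, transition Q t x y * (s y - m)) ^ 2)
      (fun x _ => mul_nonneg (hπ0 x) (sq_nonneg _)) (Finset.mem_univ x₀)
  have h4 := mul_le_mul_of_nonneg_left hV0 (Real.exp_pos (-(2 * t / K))).le
  nlinarith [hsingle, hdecay, h4]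

lemma mixingTime_le {Q : Matrix S S ℝ} (hQ : IsRateMatrix Q) {π : S → ℝ}
    (hπ0 : ∀ x, 0 ≤ π x) (hπ1 : ∑ x, π x = 1)
    (hrev : ∀ x y, π x * Q x y = π y * Q y x) {K : ℝ} (hK : 0 < K)
    (hP : ∀ f : S → ℝ, ∑ x, ∑ y, π x * π y * (f x - f y) ^ 2 ≤
      K * ∑ x, ∑ y, π x * Q x y * (f x - f y) ^ 2) {C : Set S} {T : ℝ} (hT : 0 < T)
    (hC : ∀ x ∈ C, Real.exp (-(2 * T / K)) < π x / 16) :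
    mixingTime Q C π ≤ ENNReal.ofReal T := by
  refine iInf₂_le T ⟨hT, fun x hx => ?_⟩
  have h1 := tvDist_sq_le hQ hπ0 hπ1 hrev hK hP hT.le x
  have h2 := hC x hx
  have hpos : 0 < π x := by
    have := Real.exp_pos (-(2 * T / K))
    linarith
  by_contra hge
  have h3 : (1 / 4 : ℝ) ≤ tvDist (transition Q T x) π := not_lt.1 hge
  have h4 : (1 / 16 : ℝ) ≤ tvDist (transition Q T x) π ^ 2 := by nlinarith
  have := mul_le_mul_of_nonneg_left h4 hpos.le
  linarith

/-! ### Escape times -/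

open Classical in
/-- A single grid step: the chain is in `C` at time `s` and outside `C` at time `s + h` with
probability at most `r h`, uniformly in `s`. -/
lemma measure_jump_le {Q : Matrix S S ℝ} (hQ : IsRateMatrix Q) {C : Set S} {r : ℝ}
    (hr0 : 0 ≤ r) (hr : ∀ z ∈ C, ∑ y, (if y ∈ C then 0 else Q z y) ≤ r) {x₀ : S}
    {Ω : Type*} [MeasurableSpace Ω] {μ : Measure Ω} [IsProbabilityMeasure μ]
    {X : ℝ≥0 → Ω → S} (hX : IsMarkovChain Q x₀ μ X) (s h : ℝ≥0) :
    μ {ω | X s ω ∈ C ∧ X (s + h) ω ∉ C} ≤ ENNReal.ofReal (r * h) := by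
  have hinit : μ {ω | X 0 ω ≠ x₀} = 0 := by
    have h0 := hX.law 0 (fun _ => 0) (fun _ => x₀) monotone_const rfl rfl
    simp only [Nat.le_zero_eq, forall_eq, Finset.range_zero, Finset.prod_empty,
      ENNReal.ofReal_one] at h0
    exact (prob_compl_eq_zero_iff (hX.measurable 0 x₀)).2 h0
  have hjoint : ∀ y z, μ {ω | X 0 ω = x₀ ∧ X s ω = y ∧ X (s + h) ω = z} =
      ENNReal.ofReal (transition Q s x₀ y * transition Q h y z) := by
    intro y z
    have hmono : Monotone
        (fun i : ℕ => if i = 0 then (0 : ℝ≥0) else if i = 1 then s else s + h) := by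
      refine monotone_nat_of_le_succ fun n => ?_
      rcases n with _ | _ | n <;> simp
    have h2 := hX.law 2 _
      (fun i => if i = 0 then x₀ else if i = 1 then y else z) hmono (by simp) (by simp)
    rw [Finset.prod_range_succ, Finset.prod_range_one] at h2
    simp only [zero_add, one_ne_zero, if_true, if_false, OfNat.ofNat_ne_one,
      NNReal.coe_zero, sub_zero, Nat.reduceAdd, OfNat.ofNat_ne_zero, NNReal.coe_add,
      add_sub_cancel_left] at h2
    rw [← h2]
    congr 1
    ext ω
    simp only [Set.mem_ofPred_eq]
    constructor
    · rintro ⟨h0, h1, h2⟩ i hi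
      interval_cases i <;> simp [h0, h1, h2]
    · intro H
      exact ⟨by simpa using H 0 (by norm_num), by simpa using H 1 (by norm_num),
        by simpa using H 2 (by norm_num)⟩
  have hsub : {ω | X s ω ∈ C ∧ X (s + h) ω ∉ C} ⊆ {ω | X 0 ω ≠ x₀} ∪
      ⋃ p ∈ (Finset.univ.filter fun p : S × S => p.1 ∈ C ∧ p.2 ∉ C),
        {ω | X 0 ω = x₀ ∧ X s ω = p.1 ∧ X (s + h) ω = p.2} := by
    intro ω hω
    by_cases h0 : X 0 ω = x₀
    · refine Or.inr (Set.mem_iUnion₂.2 ⟨(X s ω, X (s + h) ω), ?_, h0, rfl, rfl⟩)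
      simpa using hω
    · exact Or.inl h0
  refine (measure_mono hsub).trans ((measure_union_le _ _).trans ?_)
  rw [hinit, zero_add]
  refine (measure_biUnion_finset_le _ _).trans ?_
  simp only [hjoint]
  have hnn : ∀ y z, 0 ≤ transition Q s x₀ y * transition Q h y z := fun y z =>
    mul_nonneg (transition_nonneg hQ s.2 _ _) (transition_nonneg hQ h.2 _ _)
  rw [← ENNReal.ofReal_sum_of_nonneg fun p _ => hnn p.1 p.2]
  refine ENNReal.ofReal_le_ofReal ?_
  rw [Finset.sum_filter, Fintype.sum_prod_type]
  calc _ ≤ ∑ y, transition Q s x₀ y * (r * h) := by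
        refine Finset.sum_le_sum fun y _ => ?_
        by_cases hy : y ∈ C
        · refine le_trans (le_of_eq ?_) (mul_le_mul_of_nonneg_left
            (transition_exit_le hQ hr0 hr hy h.2) (transition_nonneg hQ s.2 _ _))
          rw [Finset.mul_sum]
          refine Finset.sum_congr rfl fun z _ => ?_
          by_cases hz : z ∈ C <;> simp [hy, hz]
        · simp only [hy, false_and, if_false, Finset.sum_const_zero]
          exact mul_nonneg (transition_nonneg hQ s.2 _ _) (mul_nonneg hr0 h.2)
    _ = r * h := by rw [← Finset.sum_mul, transition_row_sum hQ, one_mul]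

open Classical in
/-- If every state of `C` has exit rate at most `r`, the chain started in `C` leaves `C` before
time `T` with probability at most `r T`. By right-continuity an exit before `T` is seen on a
dyadic grid of `[0, T]`, and there the bound is a union bound over the jumps. -/
lemma measure_escapeTime_lt_le {Q : Matrix S S ℝ} (hQ : IsRateMatrix Q) {C : Set S} {r : ℝ}
    (hr0 : 0 ≤ r) (hr : ∀ z ∈ C, ∑ y, (if y ∈ C then 0 else Q z y) ≤ r) {x₀ : S} (hx₀ : x₀ ∈ C)
    {Ω : Type*} [MeasurableSpace Ω] {μ : Measure Ω} [IsProbabilityMeasure μ]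
    {X : ℝ≥0 → Ω → S} (hX : IsMarkovChain Q x₀ μ X) {T : ℝ} (hT : 0 < T) :
    μ {ω | escapeTime X C ω < ENNReal.ofReal T} ≤ ENNReal.ofReal (r * T) := by
  set h : ℕ → ℝ≥0 := fun j => Real.toNNReal (T / 2 ^ j) with hh
  set A : ℕ → Set Ω := fun j => {ω | X 0 ω ∈ C ∧ ∃ k : ℕ, k ≤ 2 ^ j ∧ X (k * h j) ω ∉ C} with hA
  have hinit : μ {ω | X 0 ω ∉ C} = 0 := by
    have h0 := hX.law 0 (fun _ => 0) (fun _ => x₀) monotone_const rfl rfl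
    simp only [Nat.le_zero_eq, forall_eq, Finset.range_zero, Finset.prod_empty,
      ENNReal.ofReal_one] at h0
    refine measure_mono_null ?_ ((prob_compl_eq_zero_iff (hX.measurable 0 x₀)).2 h0)
    intro ω hω he
    exact hω (he ▸ hx₀)
  have hhj : ∀ j, (h j : ℝ) = T / 2 ^ j := fun j => Real.coe_toNNReal _ (by positivity)
  have hAle : ∀ j, μ (A j) ≤ ENNReal.ofReal (r * T) := by
    intro j
    have hsub : A j ⊆ ⋃ k ∈ Finset.range (2 ^ j),
        {ω | X (k * h j) ω ∈ C ∧ X (k * h j + h j) ω ∉ C} := by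
      rintro ω ⟨h0, hk⟩
      have hfind := Nat.find_spec hk
      have hmin := fun m => Nat.find_min hk (m := m)
      set n := Nat.find hk
      rcases hn : n with _ | m
      · rw [hn] at hfind
        exact absurd h0 (by simpa using hfind.2)
      · rw [hn] at hfind hmin
        refine Set.mem_iUnion₂.2 ⟨m, Finset.mem_range.2 hfind.1, ?_, ?_⟩
        · by_contra hc
          exact hmin m (Nat.lt_succ_self m) ⟨by omega, hc⟩
        · have := hfind.2
          rwa [Nat.cast_succ, add_mul, one_mul] at this
    refine (measure_mono hsub).trans ((measure_biUnion_finset_le _ _).trans ?_)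
    refine (Finset.sum_le_sum fun (k : ℕ) _ =>
      measure_jump_le hQ hr0 hr hX ((k : ℝ≥0) * h j) (h j)).trans ?_
    rw [Finset.sum_const, Finset.card_range, nsmul_eq_mul, hhj]
    rw [← ENNReal.ofReal_natCast, ← ENNReal.ofReal_mul (by positivity)]
    refine ENNReal.ofReal_le_ofReal (le_of_eq ?_)
    push_cast
    field_simp
  have hmonoA : Monotone A := by
    refine monotone_nat_of_le_succ fun j => ?_
    rintro ω ⟨h0, k, hk, hkC⟩
    refine ⟨h0, 2 * k, by rw [pow_succ]; omega, ?_⟩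
    have : ((2 * k : ℕ) : ℝ≥0) * h (j + 1) = k * h j := by
      ext
      push_cast
      rw [hhj, hhj, pow_succ]
      field_simp
    rwa [this]
  have hcover : {ω | escapeTime X C ω < ENNReal.ofReal T} ⊆ {ω | X 0 ω ∉ C} ∪ ⋃ j, A j := by
    intro ω hω
    by_cases h0 : X 0 ω ∈ C
    swap
    · exact Or.inl h0
    refine Or.inr ?_
    simp only [escapeTime, Set.mem_ofPred_eq, iInf_lt_iff] at hω
    obtain ⟨t, htC, htT⟩ := hω
    have htT' : (t : ℝ) < T := by
      rw [← ENNReal.ofReal_coe_nnreal, ENNReal.ofReal_lt_ofReal_iff hT] at htT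
      exact htT
    have hrc := hX.right_continuous ω t
    obtain ⟨u, htu, hu⟩ := (mem_nhdsGE_iff_exists_Ico_subset).1 hrc
    -- a dyadic point of `[t, u)` below `T`
    obtain ⟨j, hj⟩ : ∃ j : ℕ, T / 2 ^ j < min (u : ℝ) T - t := by
      have hpos : 0 < (min (u : ℝ) T - t) / T :=
        div_pos (sub_pos.2 (lt_min htu htT')) hT
      obtain ⟨j, hj⟩ := exists_pow_lt_of_lt_one hpos (by norm_num : (1 / 2 : ℝ) < 1)
      refine ⟨j, ?_⟩
      rw [lt_div_iff₀ hT, div_pow, one_pow] at hj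
      calc T / 2 ^ j = 1 / 2 ^ j * T := by ring
        _ < _ := hj
    refine Set.mem_iUnion.2 ⟨j, h0, ⌈(t : ℝ) / h j⌉₊, ?_, ?_⟩
    · rw [Nat.ceil_le, hhj]
      push_cast
      rw [div_le_iff₀ (by positivity), mul_div_cancel₀ _ (by positivity)]
      exact htT'.le
    · have hp : 0 < (h j : ℝ) := by rw [hhj]; positivity
      have h1 : (t : ℝ) ≤ ⌈(t : ℝ) / h j⌉₊ * h j := by
        rw [← div_le_iff₀ hp]; exact Nat.le_ceil _
      have h2 : (⌈(t : ℝ) / h j⌉₊ * h j : ℝ) < u := by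
        have h3 : (⌈(t : ℝ) / h j⌉₊ : ℝ) < t / h j + 1 :=
          Nat.ceil_lt_add_one (div_nonneg t.2 hp.le)
        have h4 := mul_lt_mul_of_pos_right h3 hp
        rw [add_mul, one_mul, div_mul_cancel₀ _ hp.ne'] at h4
        have h5 := min_le_left (u : ℝ) T
        rw [← hhj] at hj
        linarith
      have hmem : (⌈(t : ℝ) / h j⌉₊ * h j : ℝ≥0) ∈ Set.Ico t u :=
        ⟨by exact_mod_cast h1, by exact_mod_cast h2⟩
      have := hu hmem
      simp only [Set.mem_ofPred_eq] at this
      rw [this]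
      exact htC
  refine (measure_mono hcover).trans ((measure_union_le _ _).trans ?_)
  rw [hinit, zero_add, hmonoA.measure_iUnion]
  exact iSup_le hAle

end FiniteChain

/-! ### Single-site updates -/

section Glauber

variable {N : ℕ}

/-- The configuration `σ` with the spin at `v` reversed. -/
def flip (σ : Config N) (v : Fin N) : Config N := Function.update σ v (-σ v)

lemma units_int_ne_neg (u : ℤˣ) : u ≠ -u := by
  rcases Int.units_eq_one_or u with h | h <;> rw [h] <;> decide

lemma flip_ne (σ : Config N) (v : Fin N) : flip σ v ≠ σ := by
  intro h
  have := congrFun h v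
  rw [flip, Function.update_self] at this
  exact units_int_ne_neg _ this.symm

lemma flip_flip (σ : Config N) (v : Fin N) : flip (flip σ v) v = σ := by
  simp [flip]

lemma update_eq_or_flip (σ : Config N) (v : Fin N) (s : ℤˣ) :
    Function.update σ v s = σ ∨ Function.update σ v s = flip σ v := by
  by_cases h : s = σ v
  · left; rw [h, Function.update_eq_self]
  · right
    rw [flip]
    congr 1
    rcases Int.units_eq_one_or s with h1 | h1 <;> rcases Int.units_eq_one_or (σ v) with h2 | h2 <;>
      simp_all

lemma eqOff_iff {σ η : Config N} {v : Fin N} :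
    (∀ w, w ≠ v → η w = σ w) ↔ η = σ ∨ η = flip σ v := by
  constructor
  · intro h
    have : η = Function.update σ v (η v) := by
      ext w
      by_cases hw : w = v
      · subst hw; simp
      · rw [Function.update_of_ne hw, h w hw]
    rw [this]
    simpa using update_eq_or_flip σ v (η v)
  · rintro (rfl | rfl) w hw
    · rfl
    · rw [flip, Function.update_of_ne hw]

lemma sum_eqOff (g : Config N → ℝ) (σ : Config N) (v : Fin N) :
    ∑ ζ : Config N, (if ∀ w, w ≠ v → ζ w = σ w then g ζ else 0) = g σ + g (flip σ v) := by
  simp only [eqOff_iff]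
  rw [← Finset.sum_filter]
  have : (Finset.univ.filter fun ζ => ζ = σ ∨ ζ = flip σ v) = {σ, flip σ v} := by
    ext; simp
  rw [this, Finset.sum_pair (flip_ne σ v).symm]

lemma gibbs_pos (β : ℝ) (J : Couplings N) (σ : Config N) : 0 < gibbs β J σ :=
  div_pos (Real.exp_pos _) (Finset.sum_pos (fun _ _ => Real.exp_pos _) Finset.univ_nonempty)

lemma heatBath_apply (β : ℝ) (J : Couplings N) (v : Fin N) (σ η : Config N) :
    heatBath β J v σ η = if η = σ ∨ η = flip σ v then
      gibbs β J η / (gibbs β J σ + gibbs β J (flip σ v)) else 0 := by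
  rw [heatBath, Matrix.of_apply, sum_eqOff]
  simp only [eqOff_iff]

lemma heatBath_nonneg (β : ℝ) (J : Couplings N) (v : Fin N) (σ η : Config N) :
    0 ≤ heatBath β J v σ η := by
  rw [heatBath_apply]
  split_ifs
  · exact div_nonneg (gibbs_pos _ _ _).le (add_pos (gibbs_pos _ _ _) (gibbs_pos _ _ _)).le
  · exact le_rfl

lemma heatBath_row_sum (β : ℝ) (J : Couplings N) (v : Fin N) (σ : Config N) :
    ∑ η, heatBath β J v σ η = 1 := by
  simp only [heatBath, Matrix.of_apply, sum_eqOff]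
  rw [← add_div]
  exact div_self (add_pos (gibbs_pos _ _ _) (gibbs_pos _ _ _)).ne'

lemma heatBath_reversible (β : ℝ) (J : Couplings N) (v : Fin N) (σ η : Config N) :
    gibbs β J σ * heatBath β J v σ η = gibbs β J η * heatBath β J v η σ := by
  simp only [heatBath_apply]
  by_cases h : η = σ
  · subst h; rfl
  by_cases h' : η = flip σ v
  · subst h'
    simp only [or_true, if_true, flip_flip]
    ring
  · have h2 : ¬ (σ = η ∨ σ = flip η v) := by
      rintro (e | e)
      · exact h e.symm
      · exact h' (by rw [e, flip_flip])
    rw [if_neg (by tauto), if_neg h2]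
    ring

lemma glauberGenerator_apply (β : ℝ) (J : Couplings N) (U : Set (Fin N)) (σ η : Config N) :
    glauberGenerator β J U σ η =
      open Classical in ∑ v : Fin N,
        if v ∈ U then heatBath β J v σ η - (1 : Matrix _ _ ℝ) σ η else 0 := by
  classical
  rw [glauberGenerator, Matrix.sum_apply]
  refine Finset.sum_congr rfl fun v _ => ?_
  split_ifs <;> rfl

lemma isRateMatrix_glauberGenerator (β : ℝ) (J : Couplings N) (U : Set (Fin N)) :
    IsRateMatrix (glauberGenerator β J U) := by
  classical
  constructor
  · intro σ η h
    rw [glauberGenerator_apply]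
    refine Finset.sum_nonneg fun v _ => ?_
    split_ifs
    · rw [Matrix.one_apply_ne h, sub_zero]
      exact heatBath_nonneg _ _ _ _ _
    · exact le_rfl
  · intro σ
    simp only [glauberGenerator_apply]
    rw [Finset.sum_comm]
    refine Finset.sum_eq_zero fun v _ => ?_
    split_ifs
    · rw [Finset.sum_sub_distrib, heatBath_row_sum]
      simp [Matrix.one_apply]
    · simp

lemma le_glauberGenerator_flip (β : ℝ) (J : Couplings N) {U : Set (Fin N)} {v : Fin N}
    (hv : v ∈ U) (σ : Config N) :
    gibbs β J (flip σ v) / (gibbs β J σ + gibbs β J (flip σ v)) ≤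
      glauberGenerator β J U σ (flip σ v) := by
  classical
  have h1 : gibbs β J (flip σ v) / (gibbs β J σ + gibbs β J (flip σ v)) =
      if v ∈ U then heatBath β J v σ (flip σ v) - (1 : Matrix _ _ ℝ) σ (flip σ v) else 0 := by
    rw [if_pos hv, Matrix.one_apply_ne (flip_ne σ v).symm, heatBath_apply]
    simp
  rw [h1, glauberGenerator_apply]
  refine Finset.single_le_sum
    (f := fun u => if u ∈ U then heatBath β J u σ (flip σ v) - (1 : Matrix _ _ ℝ) σ (flip σ v)
      else 0) (fun u _ => ?_) (Finset.mem_univ v)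
  split_ifs
  · rw [Matrix.one_apply_ne (flip_ne σ v).symm, sub_zero]
    exact heatBath_nonneg _ _ _ _ _
  · exact le_rfl

/-- The partition function of the Gibbs measure conditioned on `C`. -/
def partitionOn (β : ℝ) (J : Couplings N) (C : Set (Config N)) : ℝ :=
  open Classical in ∑ η : Config N, if η ∈ C then Real.exp (β * hamiltonian J η) else 0

lemma partitionOn_pos (β : ℝ) (J : Couplings N) {C : Set (Config N)} (hC : C.Nonempty) :
    0 < partitionOn β J C := by
  classical
  obtain ⟨σ, hσ⟩ := hC
  refine Finset.sum_pos' (fun η _ => ?_) ⟨σ, Finset.mem_univ _, ?_⟩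
  · split_ifs <;> positivity
  · rw [if_pos hσ]; positivity

lemma gibbsOn_of_mem (β : ℝ) (J : Couplings N) {C : Set (Config N)} {σ : Config N} (hσ : σ ∈ C) :
    gibbsOn β J C σ = Real.exp (β * hamiltonian J σ) / partitionOn β J C := by
  classical
  have hZ : 0 < ∑ η : Config N, Real.exp (β * hamiltonian J η) :=
    Finset.sum_pos (fun _ _ => Real.exp_pos _) Finset.univ_nonempty
  have hP := partitionOn_pos β J ⟨σ, hσ⟩
  have h1 : ∑ η : Config N, (if η ∈ C then gibbs β J η else 0) =
      partitionOn β J C / ∑ η : Config N, Real.exp (β * hamiltonian J η) := by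
    rw [partitionOn, Finset.sum_div]
    refine Finset.sum_congr rfl fun η _ => ?_
    split_ifs <;> simp [gibbs]
  rw [gibbsOn, if_pos hσ, h1, gibbs]
  field_simp

lemma gibbsOn_of_notMem (β : ℝ) (J : Couplings N) {C : Set (Config N)} {σ : Config N}
    (hσ : σ ∉ C) : gibbsOn β J C σ = 0 := by
  rw [gibbsOn, if_neg hσ]

lemma gibbsOn_pos (β : ℝ) (J : Couplings N) {C : Set (Config N)} {σ : Config N} (hσ : σ ∈ C) :
    0 < gibbsOn β J C σ := by
  rw [gibbsOn_of_mem β J hσ]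
  exact div_pos (Real.exp_pos _) (partitionOn_pos β J ⟨σ, hσ⟩)

lemma gibbsOn_nonneg (β : ℝ) (J : Couplings N) (C : Set (Config N)) (σ : Config N) :
    0 ≤ gibbsOn β J C σ := by
  by_cases hσ : σ ∈ C
  · exact (gibbsOn_pos β J hσ).le
  · exact (gibbsOn_of_notMem β J hσ).ge

lemma sum_gibbsOn (β : ℝ) (J : Couplings N) {C : Set (Config N)} (hC : C.Nonempty) :
    ∑ σ, gibbsOn β J C σ = 1 := by
  classical
  rw [← div_self (partitionOn_pos β J hC).ne']
  conv_rhs => rw [partitionOn, Finset.sum_div, ← partitionOn]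
  refine Finset.sum_congr rfl fun σ _ => ?_
  split_ifs with h
  · exact gibbsOn_of_mem β J h
  · rw [gibbsOn_of_notMem β J h, zero_div]

lemma gibbsOn_le_one (β : ℝ) (J : Couplings N) {C : Set (Config N)} (hC : C.Nonempty)
    (σ : Config N) : gibbsOn β J C σ ≤ 1 := by
  rw [← sum_gibbsOn β J hC]
  exact Finset.single_le_sum (f := gibbsOn β J C) (fun η _ => gibbsOn_nonneg β J C η)
    (Finset.mem_univ σ)

/-- The Gibbs measure conditioned on a set stable under the flips in `U` is reversible for the
dynamics that updates only the vertices of `U`. -/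
lemma gibbsOn_reversible (β : ℝ) (J : Couplings N) {U : Set (Fin N)} {C : Set (Config N)}
    (hCU : ∀ v ∈ U, ∀ σ ∈ C, flip σ v ∈ C) (σ η : Config N) :
    gibbsOn β J C σ * glauberGenerator β J U σ η =
      gibbsOn β J C η * glauberGenerator β J U η σ := by
  classical
  simp only [glauberGenerator_apply, Finset.mul_sum]
  refine Finset.sum_congr rfl fun v _ => ?_
  split_ifs with hv
  swap
  · simp
  by_cases hησ : η = σ
  · rw [hησ]
  rw [Matrix.one_apply_ne hησ, Matrix.one_apply_ne (Ne.symm hησ), sub_zero, sub_zero]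
  by_cases hf : η = flip σ v
  swap
  · have h2 : ¬ (σ = η ∨ σ = flip η v) := by
      rintro (e | e)
      · exact hησ e.symm
      · exact hf (by rw [e, flip_flip])
    rw [heatBath_apply, heatBath_apply, if_neg (by tauto), if_neg h2]
    simp
  by_cases hσ : σ ∈ C
  · have hη : η ∈ C := hf ▸ hCU v hv σ hσ
    have h := heatBath_reversible β J v σ η
    simp only [gibbsOn, if_pos hσ, if_pos hη, div_mul_eq_mul_div, h]
  · have hη : η ∉ C := fun hη => hσ (by
      rw [← flip_flip σ v, ← hf]; exact hCU v hv η hη)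
    rw [gibbsOn_of_notMem β J hσ, gibbsOn_of_notMem β J hη]
    simp

open Classical in
/-- The exit rate of the full dynamics from a set `C` that is stable under the flips outside `V`:
only flips at `V` contribute, each at most the ratio of the two Gibbs weights. -/
lemma glauberGenerator_exit_le (β : ℝ) (J : Couplings N) {V : Set (Fin N)} {C : Set (Config N)}
    (hCV : ∀ v ∉ V, ∀ σ ∈ C, flip σ v ∈ C) {b : ℝ} (hb : 0 ≤ b) {σ : Config N} (hσ : σ ∈ C)
    (hσb : ∀ v ∈ V, Real.exp (β * (hamiltonian J (flip σ v) - hamiltonian J σ)) ≤ b) :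
    ∑ η, (if η ∈ C then 0 else glauberGenerator β J Set.univ σ η) ≤ N * b := by
  have h1 : ∑ η, (if η ∈ C then 0 else glauberGenerator β J Set.univ σ η) =
      ∑ v : Fin N, ∑ η, (if η ∈ C then 0 else heatBath β J v σ η) := by
    rw [Finset.sum_comm]
    refine Finset.sum_congr rfl fun η _ => ?_
    by_cases h : η ∈ C
    · simp [h]
    · simp only [if_neg h, glauberGenerator_apply, Set.mem_univ, if_true]
      refine Finset.sum_congr rfl fun v _ => ?_
      rw [Matrix.one_apply_ne (fun e : σ = η => h (e ▸ hσ)), sub_zero]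
  rw [h1]
  have h2 : ∀ v : Fin N, ∑ η, (if η ∈ C then 0 else heatBath β J v σ η) ≤ b := by
    intro v
    by_cases hv : v ∈ V
    · rw [Finset.sum_eq_single_of_mem (flip σ v) (Finset.mem_univ _)]
      · split_ifs
        · exact hb
        · refine le_trans ?_ (hσb v hv)
          rw [heatBath_apply, if_pos (Or.inr rfl)]
          have hpos := gibbs_pos β J σ
          have hpos' := gibbs_pos β J (flip σ v)
          have hZ : 0 < ∑ η : Config N, Real.exp (β * hamiltonian J η) :=
            Finset.sum_pos (fun _ _ => Real.exp_pos _) Finset.univ_nonempty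
          calc _ ≤ gibbs β J (flip σ v) / gibbs β J σ := by
                gcongr
                linarith
            _ = _ := by
                rw [gibbs, gibbs, mul_sub, Real.exp_sub]
                field_simp
      · intro η _ hη
        split_ifs with h
        · rfl
        · rw [heatBath_apply, if_neg]
          rintro (e | e)
          · exact h (e ▸ hσ)
          · exact hη e
    · refine le_trans (le_of_eq (Finset.sum_eq_zero fun η _ => ?_)) hb
      split_ifs with h
      · rfl
      · rw [heatBath_apply, if_neg]
        rintro (e | e)
        · exact h (e ▸ hσ)
        · exact h (e ▸ hCV v hv σ hσ)
  calc _ ≤ ∑ _v : Fin N, b := Finset.sum_le_sum fun v _ => h2 v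
    _ = N * b := by simp

/-! ### Geometry of the wells -/

lemma spin_update_of_ne {σ : Config N} {v w : Fin N} (h : w ≠ v) (s : ℤˣ) :
    spin (Function.update σ v s) w = spin σ w := by
  rw [spin, Function.update_of_ne h, spin]

lemma spin_flip_self (σ : Config N) (v : Fin N) : spin (flip σ v) v = -spin σ v := by
  simp [spin, flip]

lemma spin_flip_of_ne {σ : Config N} {v w : Fin N} (h : w ≠ v) :
    spin (flip σ v) w = spin σ w := spin_update_of_ne h _

lemma spin_ne_zero (σ : Config N) (v : Fin N) : spin σ v ≠ 0 := by
  simp [spin]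

lemma abs_spin (σ : Config N) (v : Fin N) : |spin σ v| = 1 := by
  rcases Int.units_eq_one_or (σ v) with h | h <;> simp [spin, h]

lemma exists_flip_of_hypercube_adj {σ η : Config N} (h : (hypercube N).Adj σ η) :
    ∃ v, η = flip σ v := by
  have h1 : hammingDist σ η = 1 := h
  obtain ⟨v, hv⟩ := Finset.card_eq_one.1 h1
  refine ⟨v, ?_⟩
  have hoff : ∀ w, w ≠ v → η w = σ w := by
    intro w hw
    by_contra hne
    have : w ∈ ({v} : Finset (Fin N)) := by
      rw [← hv]
      simpa using fun e => hne e.symm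
    exact hw (Finset.mem_singleton.1 this)
  rcases eqOff_iff.1 hoff with e | e
  · subst e
    simp at hv
  · exact e

lemma hypercube_adj_flip (σ : Config N) (v : Fin N) : (hypercube N).Adj σ (flip σ v) := by
  change hammingDist σ (flip σ v) = 1
  refine Finset.card_eq_one.2 ⟨v, ?_⟩
  ext w
  simp only [Finset.mem_filter, Finset.mem_univ, true_and, Finset.mem_singleton]
  constructor
  · intro h
    by_contra hw
    exact h (by rw [flip, Function.update_of_ne hw])
  · rintro rfl
    rw [flip, Function.update_self]
    exact units_int_ne_neg _

lemma mem_satisfyingConfigs_of_eqOn {β a γ : ℝ} {J : Couplings N} {σ η : Config N}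
    (hσ : σ ∈ satisfyingConfigs β a γ J)
    (h : ∀ v ∈ relevantVertices β a γ J, η v = σ v) : η ∈ satisfyingConfigs β a γ J := by
  intro e he
  have h1 := hσ he
  have ha : spin η e.1.1 = spin σ e.1.1 := by
    rw [spin, h _ ⟨e, he, Or.inl rfl⟩, spin]
  have hb : spin η e.1.2 = spin σ e.1.2 := by
    rw [spin, h _ ⟨e, he, Or.inr rfl⟩, spin]
  change spin η e.1.1 * spin η e.1.2 = _
  rw [ha, hb]
  exact h1

/-- Reversing an endpoint of a satisfied relevant bond violates that bond. -/
lemma notMem_relevantVertices_of_flip_mem {β a γ : ℝ} {J : Couplings N} {σ : Config N}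
    {v : Fin N} (hσ : σ ∈ satisfyingConfigs β a γ J) (hf : flip σ v ∈ satisfyingConfigs β a γ J) :
    v ∉ relevantVertices β a γ J := by
  rintro ⟨e, he, hv⟩
  have h1 : spin σ e.1.1 * spin σ e.1.2 = Real.sign (J e) := hσ he
  have h2 : spin (flip σ v) e.1.1 * spin (flip σ v) e.1.2 = Real.sign (J e) := hf he
  have hne : e.1.1 ≠ e.1.2 := e.2.ne
  have h3 : spin σ e.1.1 * spin σ e.1.2 ≠ 0 := mul_ne_zero (spin_ne_zero _ _) (spin_ne_zero _ _)
  rcases hv with rfl | rfl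
  · rw [spin_flip_self, spin_flip_of_ne hne.symm, ← h1] at h2
    apply h3; linarith
  · rw [spin_flip_self, spin_flip_of_ne hne, ← h1] at h2
    apply h3; linarith

/-- Walks among satisfying configurations never change a spin at a relevant vertex. -/
lemma eqOn_of_walk {β a γ : ℝ} {J : Couplings N} {σ τ : satisfyingConfigs β a γ J}
    (p : ((hypercube N).induce (satisfyingConfigs β a γ J)).Walk σ τ) :
    ∀ v ∈ relevantVertices β a γ J, σ.1 v = τ.1 v := by
  induction p with
  | nil => exact fun _ _ => rfl
  | @cons x y z hxy p ih =>
    intro v hv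
    rw [← ih v hv]
    obtain ⟨w, hw⟩ := exists_flip_of_hypercube_adj (σ := x.1) (η := y.1) hxy
    have hwV := notMem_relevantVertices_of_flip_mem x.2 (hw ▸ y.2)
    rw [hw, flip, Function.update_of_ne (fun e : v = w => hwV (e ▸ hv))]

/-- A well consists of all configurations with a prescribed restriction to the relevant vertices
satisfying the relevant bonds. -/
lemma IsWell.exists_eq {β a γ : ℝ} {J : Couplings N} {C : Set (Config N)}
    (hC : IsWell β a γ J C) : ∃ σ₀ ∈ satisfyingConfigs β a γ J,
      C = {σ | ∀ v ∈ relevantVertices β a γ J, σ v = σ₀ v} := by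
  classical
  obtain ⟨c, rfl⟩ := hC
  obtain ⟨σ₀, rfl⟩ := c.exists_rep
  refine ⟨σ₀.1, σ₀.2, ?_⟩
  ext σ
  simp only [Set.mem_image, Set.mem_ofPred_eq]
  constructor
  · rintro ⟨τ, hτ, rfl⟩
    exact eqOn_of_walk (SimpleGraph.ConnectedComponent.exact hτ).some
  · intro h
    have key : ∀ A : Finset (Fin N), ∃ hA : A.piecewise σ σ₀.1 ∈ satisfyingConfigs β a γ J,
        ((hypercube N).induce (satisfyingConfigs β a γ J)).Reachable ⟨_, hA⟩ σ₀ := by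
      intro A
      have hmem : ∀ A : Finset (Fin N), A.piecewise σ σ₀.1 ∈ satisfyingConfigs β a γ J := by
        intro A
        refine mem_satisfyingConfigs_of_eqOn σ₀.2 fun v hv => ?_
        by_cases hvA : v ∈ A
        · rw [Finset.piecewise_eq_of_mem _ _ _ hvA, h v hv]
        · rw [Finset.piecewise_eq_of_notMem _ _ _ hvA]
      refine ⟨hmem A, ?_⟩
      induction A using Finset.induction_on with
      | empty =>
        have : (⟨(∅ : Finset (Fin N)).piecewise σ σ₀.1, hmem ∅⟩ :
            satisfyingConfigs β a γ J) = σ₀ := Subtype.ext (Finset.piecewise_empty σ σ₀.1)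
        rw [this]
      | insert v A hv ih =>
        refine SimpleGraph.Reachable.trans ?_ ih
        have hup := Finset.piecewise_insert A σ σ₀.1 v
        rcases update_eq_or_flip (A.piecewise σ σ₀.1) v (σ v) with e | e
        · have : (⟨(insert v A).piecewise σ σ₀.1, hmem _⟩ :
            satisfyingConfigs β a γ J) = ⟨A.piecewise σ σ₀.1, hmem _⟩ :=
            Subtype.ext (hup.trans e)
          rw [this]
        · refine SimpleGraph.Adj.reachable ?_
          change (hypercube N).Adj _ _
          simp only [Function.Embedding.subtype_apply]
          rw [hup, e]
          exact (hypercube_adj_flip _ v).symm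
    obtain ⟨hA, hr⟩ := key Finset.univ
    exact ⟨⟨_, hA⟩, SimpleGraph.ConnectedComponent.sound hr, Finset.piecewise_univ σ σ₀.1⟩

end Glauber

/-! ### Energy estimates for typical couplings -/

section Energy

variable {N : ℕ}

/-- The vertex `v` is an endpoint of the bond `e`. -/
def Touches (e : Bond N) (v : Fin N) : Prop := v = e.1.1 ∨ v = e.1.2

open Classical in
/-- The total strength of the bonds weaker than `L`. -/
def weakSum (J : Couplings N) (L : ℝ) : ℝ := ∑ e, if |J e| < L then |J e| else 0

lemma weakSum_nonneg (J : Couplings N) (L : ℝ) : 0 ≤ weakSum J L :=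
  Finset.sum_nonneg fun e _ => by split_ifs <;> positivity

/-- The strong bonds, those with `|J e| ≥ L`, form a matching. -/
def StrongMatching (J : Couplings N) (L : ℝ) : Prop :=
  ∀ e e' : Bond N, L ≤ |J e| → L ≤ |J e'| → ∀ v, Touches e v → Touches e' v → e = e'

lemma bond_term_flip (J : Couplings N) (e : Bond N) (σ : Config N) (v : Fin N) :
    (Touches e v → J e * spin (flip σ v) e.1.1 * spin (flip σ v) e.1.2 =
      -(J e * spin σ e.1.1 * spin σ e.1.2)) ∧
    (¬ Touches e v → J e * spin (flip σ v) e.1.1 * spin (flip σ v) e.1.2 =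
      J e * spin σ e.1.1 * spin σ e.1.2) := by
  have hne : e.1.1 ≠ e.1.2 := e.2.ne
  constructor
  · rintro (rfl | rfl)
    · rw [spin_flip_self, spin_flip_of_ne hne.symm]; ring
    · rw [spin_flip_self, spin_flip_of_ne hne]; ring
  · intro h
    have h1 : e.1.1 ≠ v := fun e' => h (Or.inl e'.symm)
    have h2 : e.1.2 ≠ v := fun e' => h (Or.inr e'.symm)
    rw [spin_flip_of_ne h1, spin_flip_of_ne h2]

lemma abs_bond_term (J : Couplings N) (e : Bond N) (σ : Config N) :
    |J e * spin σ e.1.1 * spin σ e.1.2| = |J e| := by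
  rw [abs_mul, abs_mul, abs_spin, abs_spin, mul_one, mul_one]

open Classical in
/-- A single flip at `v` costs at most the strong bond at `v`, if any, and the weak bonds. -/
lemma hamiltonian_sub_flip_le {J : Couplings N} {L : ℝ} (hM : StrongMatching J L) {v : Fin N}
    {b : ℝ} (hb : 0 ≤ b) (hJ : ∀ e, Touches e v → L ≤ |J e| → |J e| ≤ b) (σ : Config N) :
    hamiltonian J σ - hamiltonian J (flip σ v) ≤ 2 * b + 2 * weakSum J L := by
  have h1 : hamiltonian J σ - hamiltonian J (flip σ v) ≤
      2 * ∑ e, (if Touches e v ∧ L ≤ |J e| then |J e| else 0) + 2 * weakSum J L := by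
    rw [hamiltonian, hamiltonian, weakSum, ← Finset.sum_sub_distrib, Finset.mul_sum,
      Finset.mul_sum, ← Finset.sum_add_distrib]
    refine Finset.sum_le_sum fun e _ => ?_
    have habs := abs_bond_term J e σ
    have hle := le_abs_self (J e * spin σ e.1.1 * spin σ e.1.2)
    rw [habs] at hle
    have hnn := abs_nonneg (J e)
    by_cases ht : Touches e v
    · rw [(bond_term_flip J e σ v).1 ht]
      by_cases hL : L ≤ |J e|
      · rw [if_pos ⟨ht, hL⟩, if_neg (not_lt.2 hL)]; linarith
      · rw [if_neg (fun h => hL h.2), if_pos (not_le.1 hL)]; linarith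
    · rw [(bond_term_flip J e σ v).2 ht, if_neg (fun h => ht h.1)]
      split_ifs <;> linarith
  refine h1.trans ?_
  gcongr
  by_cases he : ∃ e, Touches e v ∧ L ≤ |J e|
  · obtain ⟨e, he, heL⟩ := he
    rw [Finset.sum_eq_single e, if_pos ⟨he, heL⟩]
    · exact hJ e he heL
    · intro e' _ hne
      rw [if_neg]
      rintro ⟨ht, hL⟩
      exact hne (hM e' e hL heL v ht he)
    · intro h; exact absurd (Finset.mem_univ e) h
  · rw [Finset.sum_eq_zero]
    · exact hb
    · intro e _
      exact if_neg fun h => he ⟨e, h⟩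

open Classical in
/-- Reversing one endpoint of a satisfied strong bond costs almost its full strength. -/
lemma hamiltonian_flip_sub_le {J : Couplings N} {L : ℝ} (hM : StrongMatching J L) {v : Fin N}
    {e₀ : Bond N} (ht : Touches e₀ v) (hL : L ≤ |J e₀|) {σ : Config N} (hsat : e₀ ∈ sat J σ) :
    hamiltonian J (flip σ v) - hamiltonian J σ ≤ -(2 * |J e₀|) + 2 * weakSum J L := by
  have h1 : hamiltonian J (flip σ v) - hamiltonian J σ ≤
      ∑ e, (if e = e₀ then -(2 * |J e₀|) else 0) + 2 * weakSum J L := by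
    rw [hamiltonian, hamiltonian, weakSum, ← Finset.sum_sub_distrib, Finset.mul_sum,
      ← Finset.sum_add_distrib]
    refine Finset.sum_le_sum fun e _ => ?_
    have habs := abs_bond_term J e σ
    have hle := neg_abs_le (J e * spin σ e.1.1 * spin σ e.1.2)
    rw [habs] at hle
    have hnn := abs_nonneg (J e)
    by_cases he : e = e₀
    · subst he
      have hs : spin σ e.1.1 * spin σ e.1.2 = Real.sign (J e) := hsat
      have hJs : J e * Real.sign (J e) = |J e| := by
        rcases lt_trichotomy (J e) 0 with h | h | h
        · rw [Real.sign_of_neg h, abs_of_neg h]; ring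
        · rw [h]; simp
        · rw [Real.sign_of_pos h, abs_of_pos h]; ring
      rw [(bond_term_flip J e σ v).1 ht, mul_assoc, hs, hJs, if_pos rfl, if_neg (not_lt.2 hL)]
      linarith
    · rw [if_neg he]
      by_cases ht' : Touches e v
      · have hlt : |J e| < L := by
          by_contra h
          exact he (hM e e₀ (not_lt.1 h) hL v ht' ht)
        rw [(bond_term_flip J e σ v).1 ht', if_pos hlt]; linarith
      · rw [(bond_term_flip J e σ v).2 ht']
        split_ifs <;> linarith
  simpa using h1

lemma spin_piecewise (A : Finset (Fin N)) (σ η : Config N) (v : Fin N) :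
    spin (A.piecewise η σ) v = if v ∈ A then spin η v else spin σ v := by
  by_cases h : v ∈ A <;> simp [spin, h]

/-- Exchanging two configurations on a union of strong pairs and single vertices preserves the
sum of their energies, up to the weak bonds. -/
lemma hamiltonian_exchange_le {J : Couplings N} {L : ℝ} {A : Finset (Fin N)}
    (hA : ∀ e : Bond N, L ≤ |J e| → (e.1.1 ∈ A ↔ e.1.2 ∈ A)) (σ η : Config N) :
    hamiltonian J σ + hamiltonian J η ≤
      hamiltonian J (A.piecewise η σ) + hamiltonian J (A.piecewise σ η) + 4 * weakSum J L := by
  classical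
  rw [hamiltonian, hamiltonian, hamiltonian, hamiltonian, weakSum, Finset.mul_sum,
    ← Finset.sum_add_distrib, ← Finset.sum_add_distrib, ← Finset.sum_add_distrib]
  refine Finset.sum_le_sum fun e _ => ?_
  by_cases hL : |J e| < L
  · have hb := fun τ => abs_le.1 (abs_bond_term J e τ).le
    have h1 := (hb σ).2
    have h2 := (hb η).2
    have h3 := (hb (A.piecewise η σ)).1
    have h4 := (hb (A.piecewise σ η)).1
    rw [if_pos hL]
    linarith
  · have hiff := hA e (not_lt.1 hL)
    rw [if_neg hL]
    simp only [spin_piecewise]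
    by_cases h1 : e.1.1 ∈ A
    · simp only [h1, hiff.1 h1, if_true]; linarith
    · have h2 : e.1.2 ∉ A := fun h => h1 (hiff.2 h)
      simp only [h1, h2, if_false]; linarith

/-! ### The Poincaré inequality inside a well -/

open Classical in
/-- The vertices of `S` together with their partners along strong bonds. -/
def strongClosure (J : Couplings N) (L : ℝ) (S : Finset (Fin N)) : Finset (Fin N) :=
  Finset.univ.filter fun v =>
    v ∈ S ∨ ∃ e : Bond N, L ≤ |J e| ∧ Touches e v ∧ (e.1.1 ∈ S ∨ e.1.2 ∈ S)

lemma mem_strongClosure {J : Couplings N} {L : ℝ} {S : Finset (Fin N)} {v : Fin N} :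
    v ∈ strongClosure J L S ↔
      v ∈ S ∨ ∃ e : Bond N, L ≤ |J e| ∧ Touches e v ∧ (e.1.1 ∈ S ∨ e.1.2 ∈ S) := by
  simp [strongClosure]

lemma strongClosure_closed {J : Couplings N} {L : ℝ} (hM : StrongMatching J L)
    (S : Finset (Fin N)) (e : Bond N) (he : L ≤ |J e|) :
    e.1.1 ∈ strongClosure J L S ↔ e.1.2 ∈ strongClosure J L S := by
  have key : ∀ v w, Touches e v → Touches e w →
      v ∈ strongClosure J L S → w ∈ strongClosure J L S := by
    intro v w hv hw h
    rw [mem_strongClosure] at h ⊢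
    refine Or.inr ⟨e, he, hw, ?_⟩
    rcases h with h | ⟨e', he', ht', hS⟩
    · rcases hv with rfl | rfl
      · exact Or.inl h
      · exact Or.inr h
    · rw [hM e e' he he' v hv ht']
      exact hS
  exact ⟨key _ _ (Or.inl rfl) (Or.inr rfl), key _ _ (Or.inr rfl) (Or.inl rfl)⟩

lemma strongClosure_insert {J : Couplings N} {L : ℝ} (hM : StrongMatching J L)
    (S : Finset (Fin N)) (u : Fin N) :
    ∃ v w, strongClosure J L (insert u S) = insert v (insert w (strongClosure J L S)) := by
  classical
  by_cases h : ∃ e : Bond N, L ≤ |J e| ∧ Touches e u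
  · obtain ⟨e, he, heu⟩ := h
    refine ⟨e.1.1, e.1.2, ?_⟩
    ext x
    simp only [Finset.mem_insert, mem_strongClosure]
    constructor
    · rintro ((rfl | hx) | ⟨e', he', ht, hS⟩)
      · rcases heu with h | h
        · exact Or.inl h
        · exact Or.inr (Or.inl h)
      · exact Or.inr (Or.inr (Or.inl hx))
      · have hcase : Touches e' u ∨ (e'.1.1 ∈ S ∨ e'.1.2 ∈ S) := by
          rcases hS with (h | h) | (h | h)
          · exact Or.inl (Or.inl h.symm)
          · exact Or.inr (Or.inl h)
          · exact Or.inl (Or.inr h.symm)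
          · exact Or.inr (Or.inr h)
        rcases hcase with h | h
        · have := hM e' e he' he u h heu
          subst this
          rcases ht with h | h
          · exact Or.inl h
          · exact Or.inr (Or.inl h)
        · exact Or.inr (Or.inr (Or.inr ⟨e', he', ht, h⟩))
    · have hu : (e.1.1 = u ∨ e.1.1 ∈ S) ∨ (e.1.2 = u ∨ e.1.2 ∈ S) := by
        rcases heu with h | h
        · exact Or.inl (Or.inl h.symm)
        · exact Or.inr (Or.inl h.symm)
      rintro (rfl | rfl | hx | ⟨e', he', ht, hS⟩)
      · exact Or.inr ⟨e, he, Or.inl rfl, hu⟩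
      · exact Or.inr ⟨e, he, Or.inr rfl, hu⟩
      · exact Or.inl (Or.inr hx)
      · exact Or.inr ⟨e', he', ht, hS.imp Or.inr Or.inr⟩
  · refine ⟨u, u, ?_⟩
    ext x
    simp only [Finset.mem_insert, mem_strongClosure]
    constructor
    · rintro ((rfl | hx) | ⟨e', he', ht, hS⟩)
      · exact Or.inl rfl
      · exact Or.inr (Or.inr (Or.inl hx))
      · rcases hS with (h' | h') | (h' | h')
        · exact absurd ⟨e', he', Or.inl h'.symm⟩ h
        · exact Or.inr (Or.inr (Or.inr ⟨e', he', ht, Or.inl h'⟩))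
        · exact absurd ⟨e', he', Or.inr h'.symm⟩ h
        · exact Or.inr (Or.inr (Or.inr ⟨e', he', ht, Or.inr h'⟩))
    · rintro (rfl | rfl | hx | ⟨e', he', ht, hS⟩)
      · exact Or.inl (Or.inl rfl)
      · exact Or.inl (Or.inl rfl)
      · exact Or.inl (Or.inr hx)
      · exact Or.inr ⟨e', he', ht, hS.imp Or.inr Or.inr⟩

/-- Poincaré inequality for the Gibbs measure on a set `C` of configurations with frozen spins
outside `U`. Two configurations of `C` are joined by a path that exchanges the strong pairs one
after the other; the configurations on the path are one flip away from exchanges, so their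
weights are controlled by `hamiltonian_exchange_le` and `hamiltonian_sub_flip_le`. As each path
has at most `2 N` edges, the triangle inequality suffices, at the cost of a factor `4 ^ N`. -/
lemma gibbsOn_poincare {β : ℝ} (hβ : 0 ≤ β) {J : Couplings N} {L : ℝ} (hM : StrongMatching J L)
    {U : Set (Fin N)} {σ₀ : Config N} {C : Set (Config N)} (hC : C = {σ | ∀ v ∈ Uᶜ, σ v = σ₀ v})
    {b : ℝ} (hb : 0 ≤ b)
    (hJ : ∀ v ∈ U, ∀ e, Touches e v → L ≤ |J e| → |J e| ≤ b) (f : Config N → ℝ) :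
    ∑ σ, ∑ η, gibbsOn β J C σ * gibbsOn β J C η * (f σ - f η) ^ 2 ≤
      (4 ^ N * (8 * N ^ 2) * Real.exp (β * (2 * b + 6 * weakSum J L))) *
        ∑ σ, ∑ η, gibbsOn β J C σ * glauberGenerator β J U σ η * (f σ - f η) ^ 2 := by
  classical
  set π := gibbsOn β J C with hπ
  set Q := glauberGenerator β J U with hQdef
  set w := weakSum J L with hw
  set E := ∑ σ, ∑ η, π σ * Q σ η * (f σ - f η) ^ 2 with hE
  have hQ := isRateMatrix_glauberGenerator β J U
  have hπ0 : ∀ σ, 0 ≤ π σ := gibbsOn_nonneg β J C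
  have hterm : ∀ σ η, 0 ≤ π σ * Q σ η * (f σ - f η) ^ 2 := by
    intro σ η
    by_cases h : σ = η
    · subst h; simp
    · exact mul_nonneg (mul_nonneg (hπ0 σ) (hQ.nonneg σ η h)) (sq_nonneg _)
  have hE0 : 0 ≤ E := Finset.sum_nonneg fun σ _ => Finset.sum_nonneg fun η _ => hterm σ η
  have hflipC : ∀ v ∈ U, ∀ σ ∈ C, flip σ v ∈ C := by
    intro v hv σ hσ
    rw [hC] at hσ ⊢
    intro u hu
    rw [flip, Function.update_of_ne (fun e : u = v => hu (e ▸ hv))]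
    exact hσ u hu
  have hpiece : ∀ (A : Finset (Fin N)), ∀ σ ∈ C, ∀ η ∈ C, A.piecewise η σ ∈ C := by
    intro A σ hσ η hη
    rw [hC] at hσ hη ⊢
    intro v hv
    by_cases h : v ∈ A
    · rw [Finset.piecewise_eq_of_mem _ _ _ h]; exact hη v hv
    · rw [Finset.piecewise_eq_of_notMem _ _ _ h]; exact hσ v hv
  have hsame : ∀ v ∉ U, ∀ σ ∈ C, ∀ η ∈ C, σ v = η v := by
    intro v hv σ hσ η hη
    rw [hC] at hσ hη
    rw [hσ v hv, hη v hv]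
  -- a single edge of the hypercube
  have hedge : ∀ v ∈ U, ∀ x ∈ C,
      π x * (f x - f (flip x v)) ^ 2 ≤ 2 * Real.exp (β * (2 * b + 2 * w)) * E := by
    intro v hv x hx
    have hfx := hflipC v hv x hx
    set y := flip x v
    have hxy : π x * Q x y * (f x - f y) ^ 2 ≤ E :=
      (Finset.single_le_sum (f := fun η => π x * Q x η * (f x - f η) ^ 2)
        (fun η _ => hterm x η) (Finset.mem_univ y)).trans
      (Finset.single_le_sum (f := fun σ => ∑ η, π σ * Q σ η * (f σ - f η) ^ 2)
        (fun σ _ => Finset.sum_nonneg fun η _ => hterm σ η) (Finset.mem_univ x))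
    have hH := hamiltonian_sub_flip_le hM hb (hJ v hv) x
    have hg : Real.exp (-(β * (2 * b + 2 * w))) * gibbs β J x ≤ gibbs β J y := by
      rw [gibbs, gibbs, mul_div_assoc', ← Real.exp_add]
      gcongr
      have := mul_le_mul_of_nonneg_left hH hβ
      rw [mul_sub] at this
      linarith
    have hQxy : 1 / 2 * Real.exp (-(β * (2 * b + 2 * w))) ≤ Q x y := by
      refine le_trans ?_ (le_glauberGenerator_flip β J hv x)
      have h1 := gibbs_pos β J x
      have h2 := gibbs_pos β J y
      have h3 : Real.exp (-(β * (2 * b + 2 * w))) ≤ 1 := by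
        rw [Real.exp_le_one_iff, neg_nonpos]
        have := weakSum_nonneg J L
        positivity
      rw [le_div_iff₀ (add_pos h1 h2)]
      have h4 := mul_le_mul_of_nonneg_right h3 h2.le
      change 1 / 2 * Real.exp (-(β * (2 * b + 2 * w))) * (gibbs β J x + gibbs β J y) ≤ gibbs β J y
      linarith
    have h5 : π x * (1 / 2 * Real.exp (-(β * (2 * b + 2 * w)))) * (f x - f y) ^ 2 ≤ E := by
      refine le_trans ?_ hxy
      exact mul_le_mul_of_nonneg_right (mul_le_mul_of_nonneg_left hQxy (hπ0 x)) (sq_nonneg _)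
    have h6 : Real.exp (β * (2 * b + 2 * w)) * Real.exp (-(β * (2 * b + 2 * w))) = 1 := by
      rw [← Real.exp_add]; simp
    calc π x * (f x - f y) ^ 2 = 2 * Real.exp (β * (2 * b + 2 * w)) *
          (π x * (1 / 2 * Real.exp (-(β * (2 * b + 2 * w)))) * (f x - f y) ^ 2) := by
            linear_combination (-(π x * (f x - f y) ^ 2)) * h6
      _ ≤ _ := mul_le_mul_of_nonneg_left h5 (by positivity)
  -- a pair of configurations
  have hpair : ∀ σ ∈ C, ∀ η ∈ C, π σ * π η * (f σ - f η) ^ 2 ≤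
      8 * N ^ 2 * Real.exp (β * (2 * b + 6 * w)) * E := by
    intro σ hσ η hη
    have hpos : 0 < π σ * π η := mul_pos (gibbsOn_pos β J hσ) (gibbsOn_pos β J hη)
    set D := Real.sqrt (2 * Real.exp (β * (2 * b + 6 * w)) * E / (π σ * π η)) with hD
    have hD0 : 0 ≤ D := Real.sqrt_nonneg _
    have hweight : ∀ S : Finset (Fin N), π σ * π η * Real.exp (-(β * (4 * w))) ≤
        π ((strongClosure J L S).piecewise η σ) := by
      intro S
      set A := strongClosure J L S
      have h1 := hamiltonian_exchange_le (strongClosure_closed hM S) σ η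
      have hx := hpiece A σ hσ η hη
      have hy := hpiece A η hη σ hσ
      have h2 : π σ * π η * Real.exp (-(β * (4 * w))) ≤
          π (A.piecewise η σ) * π (A.piecewise σ η) := by
        simp only [hπ]
        rw [gibbsOn_of_mem β J hσ, gibbsOn_of_mem β J hη, gibbsOn_of_mem β J hx,
          gibbsOn_of_mem β J hy, div_mul_div_comm, div_mul_div_comm, div_mul_eq_mul_div,
          ← Real.exp_add, ← Real.exp_add, ← Real.exp_add]
        have hZ := partitionOn_pos β J ⟨σ, hσ⟩
        refine div_le_div_of_nonneg_right (Real.exp_le_exp.2 ?_) (mul_pos hZ hZ).le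
        have := mul_le_mul_of_nonneg_left h1 hβ
        linarith
      exact h2.trans (mul_le_of_le_one_right (hπ0 _) (gibbsOn_le_one β J ⟨σ, hσ⟩ _))
    have hstep : ∀ (v : Fin N) (x : Config N), x ∈ C → v ∈ U →
        π σ * π η * Real.exp (-(β * (4 * w))) ≤ π x → |f x - f (flip x v)| ≤ D := by
      intro v x hx hv hle
      refine Real.abs_le_sqrt ?_
      rw [le_div_iff₀ hpos]
      have h1 := hedge v hv x hx
      have h2 := mul_le_mul_of_nonneg_right hle (sq_nonneg (f x - f (flip x v)))
      have h3 : Real.exp (β * (2 * b + 6 * w)) =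
          Real.exp (β * (2 * b + 2 * w)) * Real.exp (β * (4 * w)) := by
        rw [← Real.exp_add]; ring_nf
      have h4 : Real.exp (β * (4 * w)) * Real.exp (-(β * (4 * w))) = 1 := by
        rw [← Real.exp_add]; simp
      calc (f x - f (flip x v)) ^ 2 * (π σ * π η) =
          Real.exp (β * (4 * w)) *
            (π σ * π η * Real.exp (-(β * (4 * w))) * (f x - f (flip x v)) ^ 2) := by
            linear_combination (-((f x - f (flip x v)) ^ 2 * (π σ * π η))) * h4
        _ ≤ Real.exp (β * (4 * w)) * (2 * Real.exp (β * (2 * b + 2 * w)) * E) :=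
            mul_le_mul_of_nonneg_left (h2.trans h1) (Real.exp_pos _).le
        _ = _ := by rw [h3]; ring
    have hpath : ∀ S : Finset (Fin N),
        |f σ - f ((strongClosure J L S).piecewise η σ)| ≤ 2 * S.card * D := by
      intro S
      induction S using Finset.induction_on with
      | empty =>
        have : strongClosure J L ∅ = ∅ := by
          ext v; simp [mem_strongClosure]
        rw [this, Finset.piecewise_empty]
        simp
      | insert u S hu ih =>
        obtain ⟨v, v', hvv⟩ := strongClosure_insert hM S u
        set A := strongClosure J L S with hAdef
        set B := strongClosure J L (insert u S) with hBdef
        have hx := hpiece A σ hσ η hη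
        have hm := hpiece (insert v' A) σ hσ η hη
        have hy := hpiece B σ hσ η hη
        have h1 : |f (A.piecewise η σ) - f ((insert v' A).piecewise η σ)| ≤ D := by
          have hup := Finset.piecewise_insert A η σ v'
          rcases update_eq_or_flip (A.piecewise η σ) v' (η v') with e | e
          · rw [hup, e, sub_self, abs_zero]; exact hD0
          · by_cases hv : v' ∈ U
            · rw [hup, e]
              exact hstep v' _ hx hv (hweight S)
            · rw [hup, ← hsame v' hv _ hx _ hη, Function.update_eq_self, sub_self, abs_zero]
              exact hD0
        have h2 : |f ((insert v' A).piecewise η σ) - f (B.piecewise η σ)| ≤ D := by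
          have hup : B.piecewise η σ =
              Function.update ((insert v' A).piecewise η σ) v (η v) := by
            rw [hvv]; exact Finset.piecewise_insert _ η σ v
          rcases update_eq_or_flip ((insert v' A).piecewise η σ) v (η v) with e | e
          · rw [hup, e, sub_self, abs_zero]; exact hD0
          · by_cases hv : v ∈ U
            · rw [abs_sub_comm]
              have e' : (insert v' A).piecewise η σ = flip (B.piecewise η σ) v := by
                rw [hup, e, flip_flip]
              rw [e']
              exact hstep v _ hy hv (hweight (insert u S))
            · rw [hup, ← hsame v hv _ hm _ hη, Function.update_eq_self, sub_self, abs_zero]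
              exact hD0
        rw [Finset.card_insert_of_notMem hu]
        push_cast
        have h3 := abs_sub_le (f σ) (f (A.piecewise η σ)) (f (B.piecewise η σ))
        have h4 := abs_sub_le (f (A.piecewise η σ)) (f ((insert v' A).piecewise η σ))
          (f (B.piecewise η σ))
        linarith
    have huniv : |f σ - f η| ≤ 2 * N * D := by
      have h := hpath Finset.univ
      have : strongClosure J L Finset.univ = Finset.univ := by
        ext v; simp [mem_strongClosure]
      rw [this] at h
      simpa using h
    have hsq : (f σ - f η) ^ 2 ≤ (2 * N * D) ^ 2 := by
      rw [← sq_abs]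
      exact pow_le_pow_left₀ (abs_nonneg _) huniv 2
    have hD2 : D ^ 2 = 2 * Real.exp (β * (2 * b + 6 * w)) * E / (π σ * π η) :=
      Real.sq_sqrt (by positivity)
    calc π σ * π η * (f σ - f η) ^ 2 ≤ π σ * π η * (2 * N * D) ^ 2 :=
          mul_le_mul_of_nonneg_left hsq hpos.le
      _ = π σ * π η * (4 * N ^ 2 * D ^ 2) := by ring
      _ = _ := by
        have h1 := (gibbsOn_pos β J hσ).ne'
        have h2 := (gibbsOn_pos β J hη).ne'
        rw [← hπ] at h1 h2
        rw [hD2]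
        field_simp
        ring
  have hall : ∀ σ η, π σ * π η * (f σ - f η) ^ 2 ≤
      8 * N ^ 2 * Real.exp (β * (2 * b + 6 * w)) * E := by
    intro σ η
    by_cases hσ : σ ∈ C
    · by_cases hη : η ∈ C
      · exact hpair σ hσ η hη
      · have : π η = 0 := gibbsOn_of_notMem β J hη
        rw [this, mul_zero, zero_mul]; positivity
    · have : π σ = 0 := gibbsOn_of_notMem β J hσ
      rw [this, zero_mul, zero_mul]; positivity
  have hcard : Fintype.card (Config N) = 2 ^ N := by
    simp [Config]
  calc _ ≤ ∑ _σ : Config N, ∑ _η : Config N,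
        8 * N ^ 2 * Real.exp (β * (2 * b + 6 * w)) * E :=
        Finset.sum_le_sum fun σ _ => Finset.sum_le_sum fun η _ => hall σ η
    _ = _ := by
      rw [Finset.sum_const, Finset.sum_const, Finset.card_univ, hcard, nsmul_eq_mul, nsmul_eq_mul]
      push_cast
      have : (4 : ℝ) ^ N = 2 ^ N * 2 ^ N := by rw [← mul_pow]; norm_num
      rw [this]
      ring

end Energy

/-! ### Mixing and escape for typical couplings -/

section Well

variable {N : ℕ}

/-- The deterministic properties of the couplings that control all wells at threshold `X`: strong
bonds form a matching, the weak bonds have total strength at most `S`, and no bond has strength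
within `W` of the threshold. -/
structure IsTypical (J : Couplings N) (L X W S : ℝ) : Prop where
  matching : StrongMatching J L
  weakSum_le : weakSum J L ≤ S
  gap : ∀ e, |J e| ≤ X - W ∨ X + W ≤ |J e|

lemma card_bond_le (N : ℕ) : Fintype.card (Bond N) ≤ N ^ 2 := by
  refine (Fintype.card_subtype_le _).trans ?_
  simp [sq]

lemma flip_mem_well {β a γ : ℝ} {J : Couplings N} {C : Set (Config N)} (hC : IsWell β a γ J C)
    {v : Fin N} (hv : v ∉ relevantVertices β a γ J) {σ : Config N} (hσ : σ ∈ C) :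
    flip σ v ∈ C := by
  obtain ⟨σ₀, -, rfl⟩ := hC.exists_eq
  intro u hu
  rw [flip, Function.update_of_ne (fun e : u = v => hv (e ▸ hu))]
  exact hσ u hu

/-- Inside a well the relevant bonds contribute a constant to the energy, so that the conditioned
Gibbs measure has no very small atoms even if some couplings are huge. -/
lemma le_gibbsOn_well {β a γ : ℝ} (hβ : 0 < β) (ha : 0 < a) {J : Couplings N}
    {C : Set (Config N)} (hC : IsWell β a γ J C) {σ : Config N} (hσ : σ ∈ C) :
    (2 ^ N : ℝ)⁻¹ * Real.exp (-(N ^ 2 * (a * (N : ℝ) ^ γ))) ≤ gibbsOn β J C σ := by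
  classical
  set X := a / (2 * β) * (N : ℝ) ^ γ with hX
  have hX0 : 0 ≤ X := by positivity
  have hH : ∀ η ∈ C, hamiltonian J η - hamiltonian J σ ≤ N ^ 2 * (2 * X) := by
    intro η hη
    rw [hamiltonian, hamiltonian, ← Finset.sum_sub_distrib]
    calc _ ≤ ∑ _e : Bond N, 2 * X := by
          refine Finset.sum_le_sum fun e _ => ?_
          by_cases he : e ∈ relevantBonds β a γ J
          · obtain ⟨σ₀, -, rfl⟩ := hC.exists_eq
            have h1 : ∀ v ∈ relevantVertices β a γ J, spin η v = spin σ v := by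
              intro v hv
              rw [spin, spin, hη v hv, hσ v hv]
            rw [h1 _ ⟨e, he, Or.inl rfl⟩, h1 _ ⟨e, he, Or.inr rfl⟩, sub_self]
            positivity
          · have h1 : |J e| < X := not_le.1 he
            have h2 := (abs_le.1 (abs_bond_term J e η).le).2
            have h3 := (abs_le.1 (abs_bond_term J e σ).le).1
            linarith
      _ = Fintype.card (Bond N) * (2 * X) := by simp
      _ ≤ _ := by
          gcongr
          exact_mod_cast card_bond_le N
  have h2X : β * (N ^ 2 * (2 * X)) = N ^ 2 * (a * (N : ℝ) ^ γ) := by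
    rw [hX]; field_simp
  have hZ : partitionOn β J C ≤
      2 ^ N * Real.exp (β * hamiltonian J σ + N ^ 2 * (a * (N : ℝ) ^ γ)) := by
    calc partitionOn β J C ≤
        ∑ _η : Config N, Real.exp (β * hamiltonian J σ + N ^ 2 * (a * (N : ℝ) ^ γ)) := by
          refine Finset.sum_le_sum fun η _ => ?_
          split_ifs with hη
          · refine Real.exp_le_exp.2 ?_
            have := mul_le_mul_of_nonneg_left (hH η hη) hβ.le
            rw [h2X] at this
            linarith
          · positivity
      _ = _ := by
          simp [Config]
  rw [gibbsOn_of_mem β J hσ, le_div_iff₀ (partitionOn_pos β J ⟨σ, hσ⟩)]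
  calc _ ≤ (2 ^ N : ℝ)⁻¹ * Real.exp (-(N ^ 2 * (a * (N : ℝ) ^ γ))) *
        (2 ^ N * Real.exp (β * hamiltonian J σ + N ^ 2 * (a * (N : ℝ) ^ γ))) := by gcongr
    _ = (2 ^ N : ℝ)⁻¹ * 2 ^ N * (Real.exp (-(N ^ 2 * (a * (N : ℝ) ^ γ))) *
        Real.exp (β * hamiltonian J σ + N ^ 2 * (a * (N : ℝ) ^ γ))) := by ring
    _ = _ := by
      rw [← Real.exp_add, inv_mul_cancel₀ (by positivity), one_mul]
      congr 1
      ring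

lemma wellMixingTime_le {β a γ : ℝ} (hβ : 0 < β) (ha : 0 < a) (hN : 0 < N) {J : Couplings N}
    {L W S : ℝ} (hW : 0 < W) (hWX : W ≤ a / (2 * β) * (N : ℝ) ^ γ)
    (hJ : IsTypical J L (a / (2 * β) * (N : ℝ) ^ γ) W S) {C : Set (Config N)}
    (hC : IsWell β a γ J C) {T : ℝ} (hT : 0 < T)
    (hTK : Real.exp (-(2 * T / (4 ^ N * (8 * N ^ 2) *
        Real.exp (a * (N : ℝ) ^ γ - 2 * β * W + 6 * β * S)))) <
      (2 ^ N : ℝ)⁻¹ * Real.exp (-(N ^ 2 * (a * (N : ℝ) ^ γ))) / 16) :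
    wellMixingTime β a γ J C ≤ ENNReal.ofReal T := by
  set X := a / (2 * β) * (N : ℝ) ^ γ with hX
  obtain ⟨σ₀, hσ₀, hCeq⟩ := hC.exists_eq
  have hne : C.Nonempty := ⟨σ₀, by rw [hCeq]; exact fun _ _ => rfl⟩
  have hrev := gibbsOn_reversible β J (U := (relevantVertices β a γ J)ᶜ) (C := C)
    fun v hv σ hσ => flip_mem_well hC hv hσ
  have hP := gibbsOn_poincare hβ.le hJ.matching (U := (relevantVertices β a γ J)ᶜ) (σ₀ := σ₀)
    (C := C) (by rw [hCeq, compl_compl]) (b := X - W) (by linarith) (by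
      intro v hv e ht _
      rcases hJ.gap e with h | h
      · exact h
      · exact absurd ⟨e, show X ≤ |J e| by linarith, ht⟩ hv)
  refine mixingTime_le (isRateMatrix_glauberGenerator β J _) (gibbsOn_nonneg β J C)
    (sum_gibbsOn β J hne) hrev (K := 4 ^ N * (8 * N ^ 2) *
      Real.exp (β * (2 * (X - W) + 6 * weakSum J L))) (by positivity) hP hT ?_
  intro σ hσ
  have h1 : Real.exp (β * (2 * (X - W) + 6 * weakSum J L)) ≤
      Real.exp (a * (N : ℝ) ^ γ - 2 * β * W + 6 * β * S) := by
    refine Real.exp_le_exp.2 ?_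
    have h2X : β * (2 * X) = a * (N : ℝ) ^ γ := by
      rw [hX]; field_simp
    have := mul_le_mul_of_nonneg_left hJ.weakSum_le hβ.le
    linarith
  calc _ ≤ Real.exp (-(2 * T / (4 ^ N * (8 * N ^ 2) *
        Real.exp (a * (N : ℝ) ^ γ - 2 * β * W + 6 * β * S)))) := by
        gcongr
    _ < _ := hTK
    _ ≤ _ := by
        gcongr
        exact le_gibbsOn_well hβ ha hC hσ

lemma measure_escape_well_le {β a γ : ℝ} (hβ : 0 < β) {J : Couplings N}
    {L W S : ℝ} (hW : 0 < W) (hL : L ≤ a / (2 * β) * (N : ℝ) ^ γ)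
    (hJ : IsTypical J L (a / (2 * β) * (N : ℝ) ^ γ) W S) {C : Set (Config N)}
    (hC : IsWell β a γ J C) {σ : Config N} (hσ : σ ∈ C) {Ω : Type*} [MeasurableSpace Ω]
    {μ : Measure Ω} [IsProbabilityMeasure μ] {X : ℝ≥0 → Ω → Config N}
    (hX : IsMarkovChain (glauberGenerator β J Set.univ) σ μ X) {T : ℝ} (hT : 0 < T) :
    μ {ω | escapeTime X C ω < ENNReal.ofReal T} ≤ ENNReal.ofReal
      (N * Real.exp (-(a * (N : ℝ) ^ γ) - 2 * β * W + 2 * β * S) * T) := by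
  have hnn : 0 ≤ Real.exp (-(a * (N : ℝ) ^ γ) - 2 * β * W + 2 * β * S) := (Real.exp_pos _).le
  refine measure_escapeTime_lt_le (isRateMatrix_glauberGenerator β J _) (by positivity) ?_ hσ hX hT
  intro τ hτ
  refine glauberGenerator_exit_le β J (V := relevantVertices β a γ J)
    (fun v hv σ hσ => flip_mem_well hC hv hσ) hnn hτ ?_
  rintro v ⟨e, he, ht⟩
  have he' : a / (2 * β) * (N : ℝ) ^ γ ≤ |J e| := he
  have hsat : e ∈ sat J τ := by
    obtain ⟨σ₀, hσ₀, rfl⟩ := hC.exists_eq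
    exact mem_satisfyingConfigs_of_eqOn hσ₀ hτ he
  have h1 := hamiltonian_flip_sub_le hJ.matching (v := v) ht (hL.trans he') hsat
  refine Real.exp_le_exp.2 ?_
  have h2 : a / (2 * β) * (N : ℝ) ^ γ + W ≤ |J e| := by
    rcases hJ.gap e with h | h
    · linarith
    · exact h
  have h2X : β * (2 * (a / (2 * β) * (N : ℝ) ^ γ)) = a * (N : ℝ) ^ γ := by
    field_simp
  have h3 := mul_le_mul_of_nonneg_left h1 hβ.le
  have h4 := mul_le_mul_of_nonneg_left h2 hβ.le
  have h5 := mul_le_mul_of_nonneg_left hJ.weakSum_le hβ.le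
  linarith

end Well

/-! ### The law of one coupling -/

section Disorder

lemma lintegral_comp_abs (g : ℝ → ℝ≥0∞) : ∫⁻ x, g |x| = 2 * ∫⁻ x in Set.Ioi (0 : ℝ), g x := by
  have h1 : ∫⁻ x in Set.Ioi (0 : ℝ), g |x| = ∫⁻ x in Set.Ioi (0 : ℝ), g x :=
    setLIntegral_congr_fun measurableSet_Ioi fun x hx => by rw [abs_of_pos hx]
  have h2 : ∫⁻ x in Set.Iic (0 : ℝ), g |x| = ∫⁻ x in Set.Ioi (0 : ℝ), g x := by
    rw [setLIntegral_congr Iio_ae_eq_Iic.symm, ← h1]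
    have := (Measure.measurePreserving_neg (volume : Measure ℝ)).setLIntegral_comp_preimage_emb
      (MeasurableEquiv.neg ℝ).measurableEmbedding (fun x => g |x|) (Set.Iio 0)
    rw [← this]
    simp
  rw [← lintegral_add_compl _ (measurableSet_Ioi (a := (0 : ℝ))), Set.compl_Ioi, h1, h2, two_mul]

/-- Tail of the Pareto density. With `y = N ^ (-1 / α)` it gives the total mass of `bondLaw`. -/
lemma lintegral_tail {α : ℝ} (hα : 0 < α) (N : ℕ) {y : ℝ} (hy : 0 < y) :
    ∫⁻ x : ℝ, ENNReal.ofReal (if y ≤ |x| then α / (2 * N) * |x| ^ (-(1 + α)) else 0) =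
      ENNReal.ofReal (y ^ (-α) / N) := by
  rw [lintegral_comp_abs fun x => ENNReal.ofReal (if y ≤ x then α / (2 * N) * x ^ (-(1 + α)) else 0)]
  have h1 : ∫⁻ x in Set.Ioi (0 : ℝ),
      ENNReal.ofReal (if y ≤ x then α / (2 * N) * x ^ (-(1 + α)) else 0) =
      ∫⁻ x in Set.Ioi y, ENNReal.ofReal (α / (2 * N) * x ^ (-(1 + α))) := by
    rw [setLIntegral_congr (Ioi_ae_eq_Ici (a := y)), ← lintegral_indicator measurableSet_Ioi,
      ← lintegral_indicator measurableSet_Ici]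
    congr 1
    ext x
    by_cases hx : y ≤ x
    · rw [Set.indicator_of_mem (Set.mem_Ioi.2 (hy.trans_le hx)),
        Set.indicator_of_mem (Set.mem_Ici.2 hx), if_pos hx]
    · rw [Set.indicator_of_notMem (s := Set.Ici y) hx]
      by_cases h0 : 0 < x
      · rw [Set.indicator_of_mem (Set.mem_Ioi.2 h0), if_neg hx, ENNReal.ofReal_zero]
      · rw [Set.indicator_of_notMem (s := Set.Ioi 0) h0]
  have hint : IntegrableOn (fun x : ℝ => α / (2 * N) * x ^ (-(1 + α))) (Set.Ioi y) :=
    (integrableOn_Ioi_rpow_of_lt (by linarith) hy).const_mul _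
  rw [h1, ← ofReal_integral_eq_lintegral_ofReal hint]
  · rw [integral_const_mul, integral_Ioi_rpow_of_lt (by linarith) hy, ← ENNReal.ofReal_ofNat,
      ← ENNReal.ofReal_mul (by norm_num)]
    congr 1
    have : -(1 + α) + 1 = -α := by ring
    rw [this]
    rcases Nat.eq_zero_or_pos N with rfl | hN
    · simp
    · field_simp
  · filter_upwards [ae_restrict_mem measurableSet_Ioi] with x hx
    have : 0 < x := hy.trans hx
    positivity

lemma isProbabilityMeasure_bondLaw {α : ℝ} (hα : 0 < α) {N : ℕ} (hN : 0 < N) :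
    IsProbabilityMeasure (bondLaw α N) := by
  constructor
  have hN' : (0 : ℝ) < N := by exact_mod_cast hN
  rw [bondLaw, withDensity_apply _ MeasurableSet.univ, Measure.restrict_univ,
    lintegral_tail hα N (Real.rpow_pos_of_pos hN' _), ← Real.rpow_mul hN'.le]
  have : -(1 / α) * -α = 1 := by field_simp
  rw [this, Real.rpow_one, div_self hN'.ne', ENNReal.ofReal_one]

lemma measurable_density (α : ℝ) (N : ℕ) : Measurable fun x : ℝ =>
    ENNReal.ofReal
      (if (N : ℝ) ^ (-(1 / α)) ≤ |x| then α / (2 * N) * |x| ^ (-(1 + α)) else 0) := by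
  refine ENNReal.measurable_ofReal.comp (Measurable.ite ?_ ?_ measurable_const)
  · exact measurableSet_le measurable_const measurable_id.abs
  · exact ((measurable_id.abs).pow_const _).const_mul _

lemma bondLaw_tail_le {α : ℝ} (hα : 0 < α) (N : ℕ) {y : ℝ} (hy : 0 < y) :
    bondLaw α N {x | y ≤ |x|} ≤ ENNReal.ofReal (y ^ (-α) / N) := by
  have hm : MeasurableSet {x : ℝ | y ≤ |x|} := measurableSet_le measurable_const measurable_id.abs
  rw [bondLaw, withDensity_apply _ hm, ← lintegral_tail hα N hy, ← lintegral_indicator hm]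
  refine lintegral_mono fun x => ?_
  by_cases hx : y ≤ |x|
  · rw [Set.indicator_of_mem (s := {x : ℝ | y ≤ |x|}) hx, if_pos hx]
    refine ENNReal.ofReal_le_ofReal ?_
    split_ifs
    · exact le_rfl
    · positivity
  · rw [Set.indicator_of_notMem (s := {x : ℝ | y ≤ |x|}) hx]
    exact zero_le

/-- Truncated first moment of a coupling. -/
lemma lintegral_bondLaw_le {α : ℝ} (hα₀ : 0 < α) (hα₁ : α < 1) (N : ℕ) {L : ℝ} (hL : 0 < L) :
    ∫⁻ x, ENNReal.ofReal (if |x| < L then |x| else 0) ∂bondLaw α N ≤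
      ENNReal.ofReal (α / (1 - α) * L ^ (1 - α) / N) := by
  have hm : Measurable fun x : ℝ => ENNReal.ofReal (if |x| < L then |x| else 0) := by
    refine ENNReal.measurable_ofReal.comp (Measurable.ite ?_ measurable_id.abs measurable_const)
    exact measurableSet_lt measurable_id.abs measurable_const
  rw [bondLaw, lintegral_withDensity_eq_lintegral_mul _ (measurable_density α N) hm]
  calc _ ≤ ∫⁻ x : ℝ, (fun x => ENNReal.ofReal
        (if x < L then α / (2 * N) * x ^ (-α) else 0)) |x| := by
        refine lintegral_mono fun x => ?_
        simp only [Pi.mul_apply]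
        by_cases hx : |x| < L
        · rw [if_pos hx, if_pos hx]
          rcases eq_or_lt_of_le (abs_nonneg x) with h0 | h0
          · rw [← h0]; simp
          · rw [← ENNReal.ofReal_mul (by split_ifs <;> positivity)]
            refine ENNReal.ofReal_le_ofReal ?_
            split_ifs
            · refine le_of_eq ?_
              have : |x| ^ (-α) = |x| ^ (-(1 + α)) * |x| := by
                rw [← Real.rpow_add_one h0.ne']
                congr 1; ring
              rw [this]; ring
            · rw [zero_mul]; positivity
        · rw [if_neg hx]; simp
    _ = 2 * ∫⁻ x in Set.Ioo 0 L, ENNReal.ofReal (α / (2 * N) * x ^ (-α)) := by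
        rw [lintegral_comp_abs (fun x => ENNReal.ofReal (if x < L then α / (2 * N) * x ^ (-α) else 0)),
          ← lintegral_indicator measurableSet_Ioi,
          ← lintegral_indicator measurableSet_Ioo]
        congr 2
        ext x
        by_cases h0 : 0 < x
        · rw [Set.indicator_of_mem (Set.mem_Ioi.2 h0)]
          by_cases hx : x < L
          · rw [Set.indicator_of_mem (Set.mem_Ioo.2 ⟨h0, hx⟩), if_pos hx]
          · rw [Set.indicator_of_notMem (fun h => hx (Set.mem_Ioo.1 h).2), if_neg hx,
              ENNReal.ofReal_zero]
        · rw [Set.indicator_of_notMem (s := Set.Ioi 0) h0,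
            Set.indicator_of_notMem (fun h => h0 (Set.mem_Ioo.1 h).1)]
    _ = _ := by
        have hint : IntegrableOn (fun x : ℝ => α / (2 * N) * x ^ (-α)) (Set.Ioo 0 L) :=
          ((intervalIntegral.integrableOn_Ioo_rpow_iff hL).2 (by linarith)).const_mul _
        rw [← ofReal_integral_eq_lintegral_ofReal hint]
        · rw [integral_const_mul, ← integral_Ioc_eq_integral_Ioo,
            ← intervalIntegral.integral_of_le hL.le, integral_rpow (Or.inl (by linarith)),
            ← ENNReal.ofReal_ofNat, ← ENNReal.ofReal_mul (by norm_num)]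
          congr 1
          have h1 : -α + 1 = 1 - α := by ring
          have h2 : (1 - α) ≠ 0 := by linarith
          rw [h1, Real.zero_rpow h2]
          rcases Nat.eq_zero_or_pos N with rfl | hN
          · simp
          · field_simp
            ring
        · filter_upwards [ae_restrict_mem measurableSet_Ioo] with x hx
          have : 0 < x := hx.1
          positivity

/-- A coupling has strength close to a large value `X` with small probability. -/
lemma bondLaw_window_le {α : ℝ} (hα : 0 < α) (N : ℕ) {X W : ℝ} (hW : 0 < W) (hWX : W < X) :
    bondLaw α N {x | X - W < |x| ∧ |x| < X + W} ≤
      ENNReal.ofReal (2 * α * W * (X - W) ^ (-(1 + α)) / N) := by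
  have hm : MeasurableSet {x : ℝ | X - W < |x| ∧ |x| < X + W} :=
    (measurableSet_lt measurable_const measurable_id.abs).inter
      (measurableSet_lt measurable_id.abs measurable_const)
  have hd : 0 < X - W := by linarith
  rw [bondLaw, withDensity_apply _ hm]
  have hsub : {x : ℝ | X - W < |x| ∧ |x| < X + W} ⊆
      Set.Ioo (X - W) (X + W) ∪ Set.Ioo (-(X + W)) (-(X - W)) := by
    rintro x ⟨h1, h2⟩
    rcases le_total 0 x with h | h
    · rw [abs_of_nonneg h] at h1 h2
      exact Or.inl ⟨h1, h2⟩
    · rw [abs_of_nonpos h] at h1 h2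
      exact Or.inr ⟨by linarith, by linarith⟩
  have hvol : volume {x : ℝ | X - W < |x| ∧ |x| < X + W} ≤ ENNReal.ofReal (4 * W) := by
    refine (measure_mono hsub).trans ((measure_union_le _ _).trans ?_)
    rw [Real.volume_Ioo, Real.volume_Ioo, ← ENNReal.ofReal_add (by linarith) (by linarith)]
    refine ENNReal.ofReal_le_ofReal ?_
    linarith
  calc _ ≤ ∫⁻ _x in {x : ℝ | X - W < |x| ∧ |x| < X + W},
        ENNReal.ofReal (α / (2 * N) * (X - W) ^ (-(1 + α))) := by
        refine setLIntegral_mono' hm fun x hx => ENNReal.ofReal_le_ofReal ?_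
        split_ifs
        · refine mul_le_mul_of_nonneg_left ?_ (by positivity)
          exact Real.rpow_le_rpow_of_nonpos hd hx.1.le (by linarith)
        · positivity
    _ = ENNReal.ofReal (α / (2 * N) * (X - W) ^ (-(1 + α))) * volume _ := setLIntegral_const _ _
    _ ≤ ENNReal.ofReal (α / (2 * N) * (X - W) ^ (-(1 + α))) * ENNReal.ofReal (4 * W) := by gcongr
    _ = _ := by
        rw [← ENNReal.ofReal_mul (by positivity)]
        congr 1
        rcases Nat.eq_zero_or_pos N with rfl | hN
        · simp
        · field_simp
          ring

/-! ### The probability of typical couplings -/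

variable {N : ℕ}

lemma couplingLaw_pair_le {α : ℝ} (hα : 0 < α) (hN : 0 < N) {L : ℝ} (hL : 0 < L)
    {e e' : Bond N} (hne : e ≠ e') :
    couplingLaw α N {J | L ≤ |J e| ∧ L ≤ |J e'|} ≤ ENNReal.ofReal ((L ^ (-α) / N) ^ 2) := by
  classical
  have := isProbabilityMeasure_bondLaw hα hN
  have hset : {J : Couplings N | L ≤ |J e| ∧ L ≤ |J e'|} =
      Set.univ.pi fun i =>
        if i ∈ ({e, e'} : Finset (Bond N)) then {x : ℝ | L ≤ |x|} else Set.univ := by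
    ext J
    simp only [Set.mem_pi, Set.mem_univ, true_implies, Set.mem_ofPred_eq]
    constructor
    · rintro ⟨h1, h2⟩ i
      split_ifs with hi
      · rcases Finset.mem_insert.1 hi with rfl | hi
        · exact h1
        · rw [Finset.mem_singleton.1 hi]; exact h2
      · trivial
    · intro h
      have h1 := h e
      have h2 := h e'
      rw [if_pos (by simp)] at h1 h2
      exact ⟨h1, h2⟩
  rw [couplingLaw, hset, Measure.pi_pi]
  have : ∀ i : Bond N, bondLaw α N
      (if i ∈ ({e, e'} : Finset (Bond N)) then {x : ℝ | L ≤ |x|} else Set.univ) =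
      if i ∈ ({e, e'} : Finset (Bond N)) then bondLaw α N {x : ℝ | L ≤ |x|} else 1 := by
    intro i
    split_ifs
    · rfl
    · exact measure_univ
  simp only [this]
  rw [Finset.prod_ite_mem, Finset.univ_inter, Finset.prod_pair hne, ← sq,
    ENNReal.ofReal_pow (by positivity)]
  exact pow_le_pow_left' (bondLaw_tail_le hα N hL) 2

lemma card_touches_le (v : Fin N) [DecidablePred fun e : Bond N => Touches e v] :
    (Finset.univ.filter fun e : Bond N => Touches e v).card ≤ N := by
  classical
  calc _ ≤ (Finset.univ : Finset (Fin N)).card := by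
        refine Finset.card_le_card_of_injOn
          (fun e : Bond N => if v = e.1.1 then e.1.2 else e.1.1) (fun _ _ => Finset.mem_univ _) ?_
        intro e he e' he' h
        have h1 : Touches e v := by simpa using he
        have h2 : Touches e' v := by simpa using he'
        have hl := e.2
        have hl' := e'.2
        refine Subtype.ext (Prod.ext ?_ ?_)
        all_goals
          simp only [Touches] at h1 h2
          simp only at h
          split_ifs at h <;> grind
    _ = N := by simp

lemma couplingLaw_not_matching_le {α : ℝ} (hα : 0 < α) (hN : 0 < N) {L : ℝ} (hL : 0 < L) :
    couplingLaw α N {J | ¬ StrongMatching J L} ≤ ENNReal.ofReal (N * L ^ (-(2 * α))) := by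
  classical
  set F : Fin N → Finset (Bond N) := fun v => Finset.univ.filter fun e => Touches e v with hF
  have hsub : {J : Couplings N | ¬ StrongMatching J L} ⊆ ⋃ v ∈ (Finset.univ : Finset (Fin N)),
      ⋃ e ∈ F v, ⋃ e' ∈ (F v).filter fun e' => e ≠ e', {J | L ≤ |J e| ∧ L ≤ |J e'|} := by
    intro J hJ
    simp only [Set.mem_ofPred_eq, StrongMatching] at hJ
    push Not at hJ
    obtain ⟨e, e', h1, h2, v, hv, hv', hne⟩ := hJ
    simp only [Set.mem_iUnion]
    exact ⟨v, Finset.mem_univ _, e, by simpa [hF] using hv, e', by simpa [hF] using ⟨hv', hne⟩,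
      h1, h2⟩
  set p : ℝ := (L ^ (-α) / N) ^ 2 with hp
  refine (measure_mono hsub).trans ?_
  calc _ ≤ ∑ v : Fin N, ∑ e ∈ F v, ∑ e' ∈ (F v).filter fun e' => e ≠ e', ENNReal.ofReal p := by
        refine (measure_biUnion_finset_le _ _).trans (Finset.sum_le_sum fun v _ => ?_)
        refine (measure_biUnion_finset_le _ _).trans (Finset.sum_le_sum fun e _ => ?_)
        refine (measure_biUnion_finset_le _ _).trans (Finset.sum_le_sum fun e' he' => ?_)
        exact couplingLaw_pair_le hα hN hL (Finset.mem_filter.1 he').2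
    _ ≤ ∑ _v : Fin N, (N : ℝ≥0∞) * (N * ENNReal.ofReal p) := by
        refine Finset.sum_le_sum fun v _ => ?_
        calc _ ≤ ∑ e ∈ F v, (N : ℝ≥0∞) * ENNReal.ofReal p := by
              refine Finset.sum_le_sum fun e _ => ?_
              rw [Finset.sum_const, nsmul_eq_mul]
              gcongr
              exact (Finset.card_filter_le _ _).trans (card_touches_le v)
          _ ≤ _ := by
              rw [Finset.sum_const, nsmul_eq_mul]
              gcongr
              exact card_touches_le v
    _ = _ := by
        have hN' : (0 : ℝ) < N := by exact_mod_cast hN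
        rw [Finset.sum_const, Finset.card_univ, Fintype.card_fin, nsmul_eq_mul,
          ← ENNReal.ofReal_natCast, ← ENNReal.ofReal_mul hN'.le, ← ENNReal.ofReal_mul hN'.le,
          ← ENNReal.ofReal_mul hN'.le]
        congr 1
        have : L ^ (-(2 * α)) = (L ^ (-α)) ^ 2 := by
          rw [← Real.rpow_natCast, ← Real.rpow_mul hL.le]
          congr 1
          push_cast; ring
        rw [hp, this]
        field_simp

lemma couplingLaw_weakSum_gt_le {α : ℝ} (hα₀ : 0 < α) (hα₁ : α < 1) (hN : 0 < N) {L S : ℝ}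
    (hL : 0 < L) (hS : 0 < S) :
    couplingLaw α N {J | S < weakSum J L} ≤
      ENNReal.ofReal (N * (α / (1 - α) * L ^ (1 - α)) / S) := by
  classical
  have := isProbabilityMeasure_bondLaw hα₀ hN
  have hN' : (0 : ℝ) < N := by exact_mod_cast hN
  have h1α : 0 < 1 - α := by linarith
  have hg : Measurable fun x : ℝ => ENNReal.ofReal (if |x| < L then |x| else 0) := by
    refine ENNReal.measurable_ofReal.comp (Measurable.ite ?_ measurable_id.abs measurable_const)
    exact measurableSet_lt measurable_id.abs measurable_const
  have hw : ∀ J : Couplings N, ENNReal.ofReal (weakSum J L) =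
      ∑ e, ENNReal.ofReal (if |J e| < L then |J e| else 0) := by
    intro J
    rw [weakSum, ENNReal.ofReal_sum_of_nonneg]
    · intro e _; split_ifs <;> positivity
  have hmean : ∫⁻ J, ENNReal.ofReal (weakSum J L) ∂couplingLaw α N ≤
      ENNReal.ofReal (N * (α / (1 - α) * L ^ (1 - α))) := by
    simp only [hw]
    have hge : ∀ e ∈ (Finset.univ : Finset (Bond N)), Measurable fun J : Couplings N =>
        ENNReal.ofReal (if |J e| < L then |J e| else 0) :=
      fun e _ => hg.comp (measurable_pi_apply e)
    rw [lintegral_finsetSum _ hge]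
    have hone : ∀ e : Bond N,
        ∫⁻ J, ENNReal.ofReal (if |J e| < L then |J e| else 0) ∂couplingLaw α N ≤
          ENNReal.ofReal (α / (1 - α) * L ^ (1 - α) / N) := by
      intro e
      have hmp : MeasurePreserving (Function.eval e) (couplingLaw α N) (bondLaw α N) :=
        measurePreserving_eval _ e
      have := lintegral_bondLaw_le hα₀ hα₁ N hL
      rw [← hmp.lintegral_comp hg] at this
      exact this
    calc _ ≤ ∑ _e : Bond N, ENNReal.ofReal (α / (1 - α) * L ^ (1 - α) / N) :=
          Finset.sum_le_sum fun e _ => hone e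
      _ = (Fintype.card (Bond N) : ℝ≥0∞) * ENNReal.ofReal (α / (1 - α) * L ^ (1 - α) / N) := by
          rw [Finset.sum_const, Finset.card_univ, nsmul_eq_mul]
      _ ≤ ((N ^ 2 : ℕ) : ℝ≥0∞) * ENNReal.ofReal (α / (1 - α) * L ^ (1 - α) / N) := by
          gcongr
          exact card_bond_le N
      _ = _ := by
          rw [← ENNReal.ofReal_natCast, ← ENNReal.ofReal_mul (by positivity)]
          congr 1
          push_cast
          field_simp
  have hmeas : AEMeasurable (fun J : Couplings N => ENNReal.ofReal (weakSum J L))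
      (couplingLaw α N) := by
    simp only [hw]
    exact (Finset.measurable_fun_sum _ fun e _ => hg.comp (measurable_pi_apply e)).aemeasurable
  have hmarkov := mul_meas_ge_le_lintegral₀ hmeas (ENNReal.ofReal S)
  have hsub : {J : Couplings N | S < weakSum J L} ⊆
      {J | ENNReal.ofReal S ≤ ENNReal.ofReal (weakSum J L)} :=
    fun J hJ => ENNReal.ofReal_le_ofReal (le_of_lt hJ)
  refine (measure_mono hsub).trans ?_
  rw [ENNReal.ofReal_div_of_pos hS, ENNReal.le_div_iff_mul_le (by simp [hS]) (by simp), mul_comm]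
  exact hmarkov.trans hmean

lemma couplingLaw_not_gap_le {α : ℝ} (hα : 0 < α) (hN : 0 < N) {X W : ℝ} (hW : 0 < W)
    (hWX : W < X) :
    couplingLaw α N {J | ¬ ∀ e, |J e| ≤ X - W ∨ X + W ≤ |J e|} ≤
      ENNReal.ofReal (N * (2 * α * W * (X - W) ^ (-(1 + α)))) := by
  have := isProbabilityMeasure_bondLaw hα hN
  have hN' : (0 : ℝ) < N := by exact_mod_cast hN
  have hd : 0 < X - W := by linarith
  have hsub : {J : Couplings N | ¬ ∀ e, |J e| ≤ X - W ∨ X + W ≤ |J e|} ⊆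
      ⋃ e ∈ (Finset.univ : Finset (Bond N)),
        Function.eval e ⁻¹' {x : ℝ | X - W < |x| ∧ |x| < X + W} := by
    intro J hJ
    simp only [Set.mem_ofPred_eq] at hJ
    push Not at hJ
    obtain ⟨e, he⟩ := hJ
    simp only [Set.mem_iUnion]
    exact ⟨e, Finset.mem_univ _, he⟩
  have hm : MeasurableSet {x : ℝ | X - W < |x| ∧ |x| < X + W} :=
    (measurableSet_lt measurable_const measurable_id.abs).inter
      (measurableSet_lt measurable_id.abs measurable_const)
  refine (measure_mono hsub).trans ((measure_biUnion_finset_le _ _).trans ?_)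
  calc _ ≤ ∑ _e : Bond N, ENNReal.ofReal (2 * α * W * (X - W) ^ (-(1 + α)) / N) := by
        refine Finset.sum_le_sum fun e _ => ?_
        have hmp : MeasurePreserving (Function.eval e) (couplingLaw α N) (bondLaw α N) :=
          measurePreserving_eval _ e
        rw [hmp.measure_preimage hm.nullMeasurableSet]
        exact bondLaw_window_le hα N hW hWX
    _ = (Fintype.card (Bond N) : ℝ≥0∞) *
        ENNReal.ofReal (2 * α * W * (X - W) ^ (-(1 + α)) / N) := by
        rw [Finset.sum_const, Finset.card_univ, nsmul_eq_mul]
    _ ≤ ((N ^ 2 : ℕ) : ℝ≥0∞) * ENNReal.ofReal (2 * α * W * (X - W) ^ (-(1 + α)) / N) := by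
        gcongr
        exact card_bond_le N
    _ = _ := by
        rw [← ENNReal.ofReal_natCast, ← ENNReal.ofReal_mul (by positivity)]
        congr 1
        push_cast
        field_simp

lemma couplingLaw_not_typical_le {α : ℝ} (hα₀ : 0 < α) (hα₁ : α < 1) (hN : 0 < N)
    {L X W S : ℝ} (hL : 0 < L) (hS : 0 < S) (hW : 0 < W) (hWX : W < X) :
    couplingLaw α N {J | ¬ IsTypical J L X W S} ≤
      ENNReal.ofReal (N * L ^ (-(2 * α)) + N * (α / (1 - α) * L ^ (1 - α)) / S +
        N * (2 * α * W * (X - W) ^ (-(1 + α)))) := by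
  have hd : 0 < X - W := by linarith
  have h1α : 0 < 1 - α := by linarith
  have hsub : {J : Couplings N | ¬ IsTypical J L X W S} ⊆
      ({J | ¬ StrongMatching J L} ∪ {J | S < weakSum J L}) ∪
        {J | ¬ ∀ e, |J e| ≤ X - W ∨ X + W ≤ |J e|} := by
    intro J hJ
    by_contra h
    simp only [Set.mem_union, Set.mem_ofPred_eq, not_or, not_not, not_lt] at h
    exact hJ ⟨h.1.1, h.1.2, h.2⟩
  refine (measure_mono hsub).trans ((measure_union_le _ _).trans ?_)
  rw [ENNReal.ofReal_add (by positivity) (by positivity),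
    ENNReal.ofReal_add (by positivity) (by positivity)]
  refine add_le_add ((measure_union_le _ _).trans (add_le_add ?_ ?_)) ?_
  · exact couplingLaw_not_matching_le hα₀ hN hL
  · exact couplingLaw_weakSum_gt_le hα₀ hα₁ hN hL hS
  · exact couplingLaw_not_gap_le hα₀ hN hW hWX

end Disorder

/-! ### Asymptotics -/

section Asymptotics

/-- The exponents for which the argument runs: strong bonds have strength at least `N ^ κ`, weak
bonds sum to at most `N ^ s`, and the threshold `N ^ γ` is isolated by a window of width `N ^ θ`. -/
lemma exists_exponents {α γ : ℝ} (hα₀ : 0 < α) (hα₁ : α < 1)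
    (hγ₀ : (5 * α + 1) / (2 * α * (2 * α + 1)) < γ) (hγ₁ : γ < 1 / α) :
    ∃ κ s θ : ℝ, 1 < 2 * α * κ ∧ κ < γ ∧ 1 + κ * (1 - α) < s ∧ 1 < s ∧ s < θ ∧
      θ + 1 < γ * (1 + α) ∧ θ < γ := by
  rw [div_lt_iff₀ (by positivity)] at hγ₀
  rw [lt_div_iff₀ hα₀] at hγ₁
  have h1α : 0 < 1 - α := by linarith
  have h1 : 1 / (2 * α) < γ := by
    rw [div_lt_iff₀ (by positivity)]
    by_contra h
    push Not at h
    nlinarith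
  have h2 : 1 / (2 * α) < (γ * (1 + α) - 2) / (1 - α) := by
    rw [div_lt_div_iff₀ (by positivity) h1α]
    -- the claim is `1 + 3 α < 2 α γ (1 + α)`, and `(1 + 3 α) (2 α + 1) < (5 α + 1) (1 + α)`
    have h3 : (1 + 3 * α) * (2 * α + 1) < 2 * α * γ * (1 + α) * (2 * α + 1) := by
      have h4 := mul_lt_mul_of_pos_right hγ₀ (by linarith : 0 < 1 + α)
      nlinarith [mul_pos hα₀ h1α]
    have h5 := lt_of_mul_lt_mul_right h3 (by linarith)
    linarith
  obtain ⟨κ, hκ1, hκ2⟩ := exists_between (lt_min h1 h2)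
  have hκγ := hκ2.trans_le (min_le_left _ _)
  have hκ3 := hκ2.trans_le (min_le_right _ _)
  rw [lt_div_iff₀ h1α] at hκ3
  obtain ⟨s, hs1, hs2⟩ := exists_between (show 1 + κ * (1 - α) < γ * (1 + α) - 1 by linarith)
  obtain ⟨θ, hθ1, hθ2⟩ := exists_between hs2
  have hκ0 : 0 < κ := lt_trans (by positivity) hκ1
  refine ⟨κ, s, θ, ?_, hκγ, hs1, ?_, hθ1, by linarith, by linarith⟩
  · rw [div_lt_iff₀ (by positivity)] at hκ1
    linarith
  · have := mul_pos hκ0 h1α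
    linarith

lemma tendsto_natCast_rpow_neg {p : ℝ} (hp : p < 0) :
    Tendsto (fun N : ℕ => (N : ℝ) ^ p) atTop (𝓝 0) := by
  have := (tendsto_rpow_neg_atTop (neg_pos.2 hp)).comp tendsto_natCast_atTop_atTop
  simpa [Function.comp_def] using this

lemma eventually_const_mul_rpow_le {p q : ℝ} (hpq : p < q) (A : ℝ) {B : ℝ} (hB : 0 < B) :
    ∀ᶠ N : ℕ in atTop, A * (N : ℝ) ^ p ≤ B * (N : ℝ) ^ q := by
  have h := ((tendsto_natCast_rpow_neg (sub_neg.2 hpq)).const_mul A)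
  rw [mul_zero] at h
  filter_upwards [h.eventually (gt_mem_nhds hB), eventually_gt_atTop 0] with N hN hN0
  have hN' : (0 : ℝ) < N := by exact_mod_cast hN0
  rw [Real.rpow_sub hN', mul_div_assoc', div_lt_iff₀ (by positivity)] at hN
  exact hN.le

lemma tendsto_rpow_mul_exp_neg_rpow {θ b : ℝ} (hθ : 0 < θ) (hb : 0 < b) (p : ℝ) :
    Tendsto (fun N : ℕ => (N : ℝ) ^ p * Real.exp (-(b * (N : ℝ) ^ θ))) atTop (𝓝 0) := by
  have h1 : Tendsto (fun N : ℕ => (N : ℝ) ^ θ) atTop atTop :=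
    (tendsto_rpow_atTop hθ).comp tendsto_natCast_atTop_atTop
  have h2 := (tendsto_rpow_mul_exp_neg_mul_atTop_nhds_zero (p / θ) b hb).comp h1
  refine h2.congr fun N => ?_
  simp only [Function.comp_apply]
  rw [← Real.rpow_mul (Nat.cast_nonneg N), mul_div_cancel₀ _ hθ.ne', neg_mul]

/-- The probability of atypical couplings tends to zero. -/
lemma tendsto_not_typical {α γ κ s θ c₀ : ℝ} (hα₀ : 0 < α) (hα₁ : α < 1) (hc₀ : 0 < c₀)
    (hκ : 1 < 2 * α * κ) (hs : 1 + κ * (1 - α) < s) (hθ : θ + 1 < γ * (1 + α)) (hθγ : θ < γ) :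
    Tendsto (fun N : ℕ => couplingLaw α N
      {J | ¬ IsTypical J ((N : ℝ) ^ κ) (c₀ * (N : ℝ) ^ γ) ((N : ℝ) ^ θ) ((N : ℝ) ^ s)})
      atTop (𝓝 0) := by
  have h1α : 0 < 1 - α := by linarith
  set B : ℕ → ℝ := fun N => (N : ℝ) ^ (1 - 2 * α * κ) +
    α / (1 - α) * (N : ℝ) ^ (1 + κ * (1 - α) - s) +
    2 * α * (c₀ / 2) ^ (-(1 + α)) * (N : ℝ) ^ (θ + 1 - γ * (1 + α)) with hB
  have hB0 : Tendsto (fun N => ENNReal.ofReal (B N)) atTop (𝓝 0) := by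
    rw [← ENNReal.ofReal_zero]
    refine ENNReal.tendsto_ofReal ?_
    have h1 := tendsto_natCast_rpow_neg (p := 1 - 2 * α * κ) (by linarith)
    have h2 := (tendsto_natCast_rpow_neg (p := 1 + κ * (1 - α) - s) (by linarith)).const_mul
      (α / (1 - α))
    have h3 := (tendsto_natCast_rpow_neg (p := θ + 1 - γ * (1 + α)) (by linarith)).const_mul
      (2 * α * (c₀ / 2) ^ (-(1 + α)))
    simpa [hB] using (h1.add h2).add h3
  refine tendsto_of_tendsto_of_tendsto_of_le_of_le' tendsto_const_nhds hB0
    (Eventually.of_forall fun _ => zero_le) ?_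
  filter_upwards [eventually_gt_atTop 0,
    eventually_const_mul_rpow_le hθγ 1 (half_pos hc₀)] with N hN hW
  have hN' : (0 : ℝ) < N := by exact_mod_cast hN
  have hγpos : 0 < (N : ℝ) ^ γ := by positivity
  have hprod : 0 < c₀ * (N : ℝ) ^ γ := by positivity
  refine (couplingLaw_not_typical_le hα₀ hα₁ hN (Real.rpow_pos_of_pos hN' κ)
    (Real.rpow_pos_of_pos hN' s) (Real.rpow_pos_of_pos hN' θ) (by linarith)).trans ?_
  refine ENNReal.ofReal_le_ofReal ?_
  simp only [hB]
  refine add_le_add (add_le_add (le_of_eq ?_) (le_of_eq ?_)) ?_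
  · rw [← Real.rpow_mul hN'.le, sub_eq_add_neg, Real.rpow_add hN', Real.rpow_one]
    congr 2
    ring
  · rw [← Real.rpow_mul hN'.le, Real.rpow_sub hN', Real.rpow_add hN', Real.rpow_one]
    ring
  · have h1 : (c₀ * (N : ℝ) ^ γ - (N : ℝ) ^ θ) ^ (-(1 + α)) ≤
        (c₀ / 2 * (N : ℝ) ^ γ) ^ (-(1 + α)) :=
      Real.rpow_le_rpow_of_nonpos (by positivity) (by linarith) (by linarith)
    calc _ ≤ (N : ℝ) * (2 * α * (N : ℝ) ^ θ * (c₀ / 2 * (N : ℝ) ^ γ) ^ (-(1 + α))) := by gcongr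
      _ = _ := by
        have h2 : (N : ℝ) ^ (θ + 1 - γ * (1 + α)) =
            (N : ℝ) ^ θ * N * ((N : ℝ) ^ γ) ^ (-(1 + α)) := by
          rw [← Real.rpow_mul hN'.le, ← Real.rpow_add_one hN'.ne', ← Real.rpow_add hN']
          congr 1
          ring
        rw [Real.mul_rpow (by positivity) hγpos.le, h2]
        ring

/-- At the time `e^{-N^s} t_{a,γ}` the relaxation bound beats the smallest atom of the well: the
gain `e^{2 β N^θ}` from the window dominates all other factors, as `1 < s < θ`. -/
lemma eventually_relaxed {β a γ s θ : ℝ} (hβ : 0 < β) (hγ : 0 < γ)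
    (hs : 1 < s) (hsθ : s < θ) : ∀ᶠ N : ℕ in atTop,
      Real.exp (-(2 * (Real.exp (-(N : ℝ) ^ s) * timescale a γ N) / (4 ^ N * (8 * N ^ 2) *
        Real.exp (a * (N : ℝ) ^ γ - 2 * β * (N : ℝ) ^ θ + 6 * β * (N : ℝ) ^ s)))) <
      (2 ^ N : ℝ)⁻¹ * Real.exp (-(N ^ 2 * (a * (N : ℝ) ^ γ))) / 16 := by
  have hpoly := (tendsto_rpow_mul_exp_neg_rpow (by linarith : 0 < θ) hβ (2 + γ)).const_mul (5 + a)
  rw [mul_zero] at hpoly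
  filter_upwards [eventually_ge_atTop 1, eventually_const_mul_rpow_le hsθ (8 + 6 * β) hβ,
    hpoly.eventually (gt_mem_nhds one_pos)] with N hN h1 h2
  have hN1 : (1 : ℝ) ≤ N := by exact_mod_cast hN
  have hN' : (0 : ℝ) < N := by linarith
  have hNs : (N : ℝ) ≤ (N : ℝ) ^ s := by
    simpa using Real.rpow_le_rpow_of_exponent_le hN1 hs.le
  have he1 : (2 : ℝ) ≤ Real.exp 1 := by
    have := Real.add_one_le_exp (1 : ℝ)
    linarith
  have he2 : (4 : ℝ) ^ N ≤ Real.exp (2 * N) := by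
    have : (4 : ℝ) ≤ Real.exp 2 := by
      have h : Real.exp 2 = Real.exp 1 * Real.exp 1 := by rw [← Real.exp_add]; norm_num
      nlinarith
    calc (4 : ℝ) ^ N ≤ Real.exp 2 ^ N := by gcongr
      _ = _ := by rw [← Real.exp_nat_mul]; congr 1; ring
  have he3 : 8 * (N : ℝ) ^ 2 ≤ Real.exp (5 * N) := by
    have h8 : (8 : ℝ) ≤ Real.exp (3 * N) := by
      calc (8 : ℝ) = 2 ^ 3 := by norm_num
        _ ≤ Real.exp 1 ^ 3 := by gcongr
        _ = Real.exp 3 := by rw [← Real.exp_nat_mul]; norm_num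
        _ ≤ _ := Real.exp_le_exp.2 (by linarith)
    have hNe : (N : ℝ) ≤ Real.exp N := by
      have := Real.add_one_le_exp (N : ℝ)
      linarith
    calc 8 * (N : ℝ) ^ 2 ≤ Real.exp (3 * N) * Real.exp N ^ 2 := by gcongr
      _ = _ := by
        rw [← Real.exp_nat_mul, ← Real.exp_add]
        congr 1
        push_cast
        ring
  -- the time in units of the relaxation time
  have hratio : Real.exp (β * (N : ℝ) ^ θ) ≤
      Real.exp (-(N : ℝ) ^ s) * timescale a γ N / (4 ^ N * (8 * N ^ 2) *
        Real.exp (a * (N : ℝ) ^ γ - 2 * β * (N : ℝ) ^ θ + 6 * β * (N : ℝ) ^ s)) := by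
    rw [le_div_iff₀ (by positivity), timescale, ← Real.exp_add]
    calc _ ≤ Real.exp (β * (N : ℝ) ^ θ) * (Real.exp (2 * N) * Real.exp (5 * N) *
          Real.exp (a * (N : ℝ) ^ γ - 2 * β * (N : ℝ) ^ θ + 6 * β * (N : ℝ) ^ s)) := by gcongr
      _ ≤ _ := by
        rw [← Real.exp_add, ← Real.exp_add, ← Real.exp_add]
        refine Real.exp_le_exp.2 ?_
        linarith
  have hlarge : (5 + a) * (N : ℝ) ^ (2 + γ) < Real.exp (β * (N : ℝ) ^ θ) := by
    rw [Real.exp_neg, ← mul_assoc, ← div_eq_mul_inv, div_lt_one (Real.exp_pos _)] at h2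
    exact h2
  have hpow : (N : ℝ) ^ (2 + γ) = N ^ 2 * (N : ℝ) ^ γ := by
    rw [Real.rpow_add hN', Real.rpow_two]
  have hNp : (N : ℝ) ≤ (N : ℝ) ^ (2 + γ) := by
    simpa using Real.rpow_le_rpow_of_exponent_le hN1 (by linarith : (1 : ℝ) ≤ 2 + γ)
  have h16 : (16 : ℝ) ≤ Real.exp (4 * N) := by
    calc (16 : ℝ) = 2 ^ 4 := by norm_num
      _ ≤ Real.exp 1 ^ 4 := by gcongr
      _ = Real.exp 4 := by rw [← Real.exp_nat_mul]; norm_num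
      _ ≤ _ := Real.exp_le_exp.2 (by linarith)
  have h2N : (2 : ℝ) ^ N ≤ Real.exp N := by
    calc (2 : ℝ) ^ N ≤ Real.exp 1 ^ N := by gcongr
      _ = _ := by rw [← Real.exp_nat_mul, mul_one]
  calc _ < Real.exp (-(5 * N + N ^ 2 * (a * (N : ℝ) ^ γ))) := by
        refine Real.exp_lt_exp.2 (neg_lt_neg ?_)
        rw [mul_div_assoc]
        have h3 : 0 < Real.exp (β * (N : ℝ) ^ θ) := Real.exp_pos _
        have h4 : (5 + a) * (N : ℝ) ^ (2 + γ) =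
            5 * (N : ℝ) ^ (2 + γ) + N ^ 2 * (a * (N : ℝ) ^ γ) := by rw [hpow]; ring
        linarith
    _ = (Real.exp N)⁻¹ * Real.exp (-(N ^ 2 * (a * (N : ℝ) ^ γ))) / Real.exp (4 * N) := by
        rw [← Real.exp_neg, ← Real.exp_add, ← Real.exp_sub]
        congr 1
        ring
    _ ≤ _ := by gcongr

lemma tendsto_escape_bound {β s θ : ℝ} (hβ : 0 < β) (hθ : 0 < θ) (hsθ : s < θ) :
    Tendsto (fun N : ℕ => (N : ℝ) * Real.exp (-(2 * β * (N : ℝ) ^ θ) + 2 * β * (N : ℝ) ^ s))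
      atTop (𝓝 0) := by
  refine tendsto_of_tendsto_of_tendsto_of_le_of_le' tendsto_const_nhds
    (tendsto_rpow_mul_exp_neg_rpow hθ hβ 1) (Eventually.of_forall fun N => by positivity) ?_
  filter_upwards [eventually_const_mul_rpow_le hsθ (2 * β) hβ] with N hN
  rw [Real.rpow_one]
  gcongr
  linarith

end Asymptotics

end LevySpinGlass

end

open LevySpinGlass
theorem theorem1p9 (α β a γ : ℝ) (hα₀ : 0 < α) (hα₁ : α < 1) (hβ : 0 < β) (ha : 0 < a)
    (hγ₀ : (5 * α + 1) / (2 * α * (2 * α + 1)) < γ) (hγ₁ : γ < 1 / α) :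
    ∃ η > (0 : ℝ), ∃ c > (0 : ℝ), ∃ δ : ℕ → ℝ, Tendsto δ atTop (𝓝 0) ∧
      Tendsto (fun N : ℕ => couplingLaw α N {J | ¬ ∀ C : Set (Config N), IsWell β a γ J C →
          wellMixingTime β a γ J C ≤
            ENNReal.ofReal (Real.exp (-(N : ℝ) ^ η) * timescale a γ N) ∧
          ∀ σ ∈ C, ∀ (Ω : Type) (_ : MeasurableSpace Ω) (μ : Measure Ω),
            IsProbabilityMeasure μ → ∀ X : ℝ≥0 → Ω → Config N,
              IsMarkovChain (glauberGenerator β J Set.univ) σ μ X →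
                μ {ω | escapeTime X C ω < ENNReal.ofReal (c * timescale a γ N)} ≤
                  ENNReal.ofReal (δ N)})
        atTop (𝓝 0) := by
  obtain ⟨κ, s, θ, hκ, hκγ, hs, hs1, hsθ, hθ, hθγ⟩ := exists_exponents hα₀ hα₁ hγ₀ hγ₁
  have hc₀ : 0 < a / (2 * β) := by positivity
  have hθ0 : 0 < θ := by linarith
  refine ⟨s, by linarith, 1, one_pos, _, tendsto_escape_bound hβ hθ0 hsθ, ?_⟩
  refine tendsto_of_tendsto_of_tendsto_of_le_of_le' tendsto_const_nhds
    (tendsto_not_typical hα₀ hα₁ hc₀ hκ hs hθ hθγ) (Eventually.of_forall fun _ => zero_le) ?_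
  filter_upwards [eventually_gt_atTop 0, eventually_const_mul_rpow_le hθγ 1 hc₀,
    eventually_const_mul_rpow_le hκγ 1 hc₀,
    eventually_relaxed (a := a) hβ (hθ0.trans hθγ) hs1 hsθ] with N hN hWX hLX hrelax
  rw [one_mul] at hWX hLX
  have hN' : (0 : ℝ) < N := by exact_mod_cast hN
  have hW : 0 < (N : ℝ) ^ θ := Real.rpow_pos_of_pos hN' θ
  refine measure_mono fun J hJ htyp => hJ fun C hC => ⟨?_, ?_⟩
  · exact wellMixingTime_le hβ ha hN hW hWX htyp hC
      (mul_pos (Real.exp_pos _) (Real.exp_pos _)) hrelax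
  · intro σ hσ Ω _ μ _ X hX
    rw [one_mul]
    refine (measure_escape_well_le hβ hW hLX htyp hC hσ hX (T := timescale a γ N)
      (Real.exp_pos _)).trans ?_
    refine ENNReal.ofReal_le_ofReal (le_of_eq ?_)
    rw [timescale, mul_assoc, ← Real.exp_add]
    congr 2
    ring
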